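/- Let $n>1$ and let $(M^{2n+1},\varphi,\zeta,\eta,g)$ be a Kenmotsu manifold, i.e. a smooth manifold with a Riemannian metric $g$, a $(1,1)$-tensor field $\varphi$, a unit vector field $\zeta$ (the Reeb vector field) and the $1$-form $\eta=g(\cdot,\zeta)$ such that $\varphi^2X=-X+\eta(X)\zeta$, $g(\varphi X,\varphi Y)=g(X,Y)-\eta(X)\eta(Y)$ and $(\nabla_X\varphi)Y=g(\varphi X,Y)\zeta-\eta(Y)\varphi X$ for all vector fields $X,Y$, where $\nabla$ is the Levi-Civita connection of $g$. Let $\alpha,\beta\in\mathbb R$, and suppose that $(g,V,\lambda)$ is an almost Ricci–Yamabe soliton of type $(\alpha,\beta)$ on $M$, i.e. $V$ is a smooth vector field and $\lambda$ a smooth function on $M$ with $$\mathcal L_Vg+2\alpha S=(2\lambda-\beta r)\,g,$$ where $S$ is the Ricci tensor and $r$ the scalar curvature of $g$. If $\mathrm{Hess}_\lambda(\zeta,\zeta)$ is constant along $\zeta$, i.e. $\zeta\big(\mathrm{Hess}_\lambda(\zeta,\zeta)\big)=0$, then $\lambda$ is the constant $$\lambda=-2n\alpha-n\beta(2n+1),$$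 so that $(g,V,\lambda)$ is a Ricci–Yamabe soliton of type $(\alpha,\beta)$ (the soliton equation holds with a real constant $\lambda$). -/

import Mathlib

open scoped Manifold ContDiff Bundle

noncomputable section

/-! ### Riemannian geometry in a coordinate domain of `ℝ^m`

A metric in coordinates is a map `g : ℝ^m → ℝ^m → ℝ^m → ℝ`, where `g u v w` is the value of the
metric at the point `u` on the vectors `v, w`.  All formulas are evaluated at points at which the
objects are smooth. -/

namespace Coord

variable {m : ℕ}

/-- The coordinate space `ℝ^m`. -/
abbrev Space (m : ℕ) : Type := EuclideanSpace ℝ (Fin m)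

/-- The `i`-th coordinate vector `∂_i`. -/
def basisVec (i : Fin m) : Space m := EuclideanSpace.single i (1 : ℝ)

/-- The matrix `(g_{ij})` at the point `u`. -/
def gram (g : Space m → Space m → Space m → ℝ) (u : Space m) : Matrix (Fin m) (Fin m) ℝ :=
  Matrix.of fun i j => g u (basisVec i) (basisVec j)

/-- The Christoffel symbols of the Levi-Civita connection of `g`, contracted with `v` and `w`:
`Γ(v, w)^k = (1/2) ∑_l g^{kl} (∂_v g(w, ∂_l) + ∂_w g(v, ∂_l) - ∂_l g(v, w))`. -/
def christoffel (g : Space m → Space m → Space m → ℝ) (u v w : Space m) : Space m :=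
  WithLp.toLp 2 fun k => (1 / 2 : ℝ) * ∑ l, (gram g u)⁻¹ k l *
    (fderiv ℝ (fun y => g y w (basisVec l)) u v + fderiv ℝ (fun y => g y v (basisVec l)) u w
      - fderiv ℝ (fun y => g y v w) u (basisVec l))

/-- The Levi-Civita covariant derivative `∇_X Y` of vector fields. -/
def cov (g : Space m → Space m → Space m → ℝ) (X Y : Space m → Space m) (u : Space m) : Space m :=
  fderiv ℝ Y u (X u) + christoffel g u (X u) (Y u)

/-- The curvature `R(X, Y)Z = ∇_X ∇_Y Z - ∇_Y ∇_X Z - ∇_{[X, Y]} Z` of vector fields. -/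
def curvature (g : Space m → Space m → Space m → ℝ) (X Y Z : Space m → Space m) (u : Space m) :
    Space m :=
  cov g X (cov g Y Z) u - cov g Y (cov g X Z) u - cov g (VectorField.lieBracket ℝ X Y) Z u

/-- The Ricci tensor `S(v, w) = trace (z ↦ R(z, v) w)` at the point `u`.  The curvature is a tensor,
so that it may be computed on the constant vector fields `∂_i, v, w`. -/
def ricci (g : Space m → Space m → Space m → ℝ) (u v w : Space m) : ℝ :=
  ∑ i, (curvature g (fun _ => basisVec i) (fun _ => v) (fun _ => w) u) i

/-- The scalar curvature `r = ∑_{i,j} g^{ij} S_{ij}`. -/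
def scalarCurvature (g : Space m → Space m → Space m → ℝ) (u : Space m) : ℝ :=
  ∑ i, ∑ j, (gram g u)⁻¹ i j * ricci g u (basisVec i) (basisVec j)

/-- The Lie derivative `(L_V g)(v, w) = V(g(v, w)) - g([V, v], w) - g(v, [V, w])` at the point `u`;
here `v` and `w` are extended to constant vector fields. -/
def lieMetric (g : Space m → Space m → Space m → ℝ) (V : Space m → Space m) (u v w : Space m) : ℝ :=
  fderiv ℝ (fun y => g y v w) u (V u)
    - g u (VectorField.lieBracket ℝ V (fun _ => v) u) w
    - g u v (VectorField.lieBracket ℝ V (fun _ => w) u)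

/-- The Hessian `Hess_f(v, w) = v(w f) - (∇_v w) f` at the point `u`; here `w` is extended to a
constant vector field. -/
def hessian (g : Space m → Space m → Space m → ℝ) (f : Space m → ℝ) (u v w : Space m) : ℝ :=
  fderiv ℝ (fun y => fderiv ℝ f y w) u v - fderiv ℝ f u (cov g (fun _ => v) (fun _ => w) u)

/-- The covariant derivative `(∇_v φ) w = ∇_v (φ w) - φ (∇_v w)` of a `(1,1)`-tensor field at the
point `u`; here `v` and `w` are extended to constant vector fields. -/
def covEndo (g : Space m → Space m → Space m → ℝ) (φ : Space m → Space m → Space m)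
    (u v w : Space m) : Space m :=
  cov g (fun _ => v) (fun y => φ y w) u - φ u (cov g (fun _ => v) (fun _ => w) u)

end Coord

/-! ### Tensor fields on a smooth manifold and their coordinate expressions -/

section Manifolds

variable {m : ℕ} {M : Type*} [TopologicalSpace M] [ChartedSpace (EuclideanSpace ℝ (Fin m)) M]

/-- A smooth Riemannian metric on a smooth manifold `M` of dimension `m`. -/
abbrev SmoothMetric (m : ℕ) (M : Type*) [TopologicalSpace M]
    [ChartedSpace (EuclideanSpace ℝ (Fin m)) M] [IsManifold (𝓡 m) ∞ M] :=
  Bundle.ContMDiffRiemannianMetric (𝓡 m) ∞ (EuclideanSpace ℝ (Fin m))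
    (fun x : M => TangentSpace (𝓡 m) x)

/-- A smooth vector field on `M`. -/
abbrev SmoothVectorField (m : ℕ) (M : Type*) [TopologicalSpace M]
    [ChartedSpace (EuclideanSpace ℝ (Fin m)) M] [IsManifold (𝓡 m) ∞ M] :=
  ContMDiffSection (𝓡 m) (EuclideanSpace ℝ (Fin m)) ∞ (fun x : M => TangentSpace (𝓡 m) x)

/-- A smooth `(1,1)`-tensor field on `M`. -/
abbrev SmoothEndomorphism (m : ℕ) (M : Type*) [TopologicalSpace M]
    [ChartedSpace (EuclideanSpace ℝ (Fin m)) M] [IsManifold (𝓡 m) ∞ M] :=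
  ContMDiffSection (𝓡 m) (EuclideanSpace ℝ (Fin m) →L[ℝ] EuclideanSpace ℝ (Fin m)) ∞
    (fun x : M => TangentSpace (𝓡 m) x →L[ℝ] TangentSpace (𝓡 m) x)

/-- A smooth `1`-form on `M`. -/
abbrev SmoothOneForm (m : ℕ) (M : Type*) [TopologicalSpace M]
    [ChartedSpace (EuclideanSpace ℝ (Fin m)) M] [IsManifold (𝓡 m) ∞ M] :=
  ContMDiffSection (𝓡 m) (EuclideanSpace ℝ (Fin m) →L[ℝ] ℝ) ∞
    (fun x : M => TangentSpace (𝓡 m) x →L[ℝ] ℝ)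

/-- The differential `T_u ℝ^m → T_p M` of the inverse of the chart `e` at `u = e p`: it sends `∂_i`
to the `i`-th coordinate vector field of the chart. -/
def fromCoord (e : OpenPartialHomeomorph M (EuclideanSpace ℝ (Fin m)))
    (u v : EuclideanSpace ℝ (Fin m)) : TangentSpace (𝓡 m) (e.symm u) :=
  mfderiv (𝓡 m) (𝓡 m) e.symm u v

/-- The differential `T_p M → ℝ^m` of the chart `e` at `p = e⁻¹ u`. -/
def toCoord (e : OpenPartialHomeomorph M (EuclideanSpace ℝ (Fin m)))
    (u : EuclideanSpace ℝ (Fin m)) (v : TangentSpace (𝓡 m) (e.symm u)) :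
    EuclideanSpace ℝ (Fin m) :=
  mfderiv (𝓡 m) (𝓡 m) e (e.symm u) v

variable [IsManifold (𝓡 m) ∞ M]

/-- The metric in the chart `e`. -/
def SmoothMetric.inChart (g : SmoothMetric m M)
    (e : OpenPartialHomeomorph M (EuclideanSpace ℝ (Fin m))) (u v w : EuclideanSpace ℝ (Fin m)) :
    ℝ :=
  g.inner (e.symm u) (fromCoord e u v) (fromCoord e u w)

/-- The vector field in the chart `e`. -/
def SmoothVectorField.inChart (V : SmoothVectorField m M)
    (e : OpenPartialHomeomorph M (EuclideanSpace ℝ (Fin m))) (u : EuclideanSpace ℝ (Fin m)) :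
    EuclideanSpace ℝ (Fin m) :=
  toCoord e u (V (e.symm u))

/-- The `(1,1)`-tensor field in the chart `e`. -/
def SmoothEndomorphism.inChart (φ : SmoothEndomorphism m M)
    (e : OpenPartialHomeomorph M (EuclideanSpace ℝ (Fin m))) (u v : EuclideanSpace ℝ (Fin m)) :
    EuclideanSpace ℝ (Fin m) :=
  toCoord e u (φ (e.symm u) (fromCoord e u v))

/-- The `1`-form in the chart `e`. -/
def SmoothOneForm.inChart (η : SmoothOneForm m M)
    (e : OpenPartialHomeomorph M (EuclideanSpace ℝ (Fin m))) (u v : EuclideanSpace ℝ (Fin m)) :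
    ℝ :=
  η (e.symm u) (fromCoord e u v)

/-! ### Kenmotsu manifolds and Ricci–Yamabe solitons -/

/-- An almost contact metric structure `(φ, ζ, η, g)` on the smooth manifold `M`. -/
structure AlmostContactMetricStructure (m : ℕ) (M : Type*) [TopologicalSpace M]
    [ChartedSpace (EuclideanSpace ℝ (Fin m)) M] [IsManifold (𝓡 m) ∞ M] where
  /-- the Riemannian metric -/
  g : SmoothMetric m M
  /-- the structure tensor -/
  φ : SmoothEndomorphism m M
  /-- the Reeb vector field -/
  ζ : SmoothVectorField m M
  /-- the contact form -/
  η : SmoothOneForm m M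
  unit : ∀ x, g.inner x (ζ x) (ζ x) = 1
  eta_eq : ∀ (x : M) (v : TangentSpace (𝓡 m) x), η x v = g.inner x v (ζ x)
  phi_sq : ∀ (x : M) (v : TangentSpace (𝓡 m) x), φ x (φ x v) = -v + η x v • ζ x
  compatible : ∀ (x : M) (v w : TangentSpace (𝓡 m) x),
    g.inner x (φ x v) (φ x w) = g.inner x v w - η x v * η x w

/-- Kenmotsu's condition `(∇_X φ) Y = g(φ X, Y) ζ - η(Y) φ X`, in every smooth chart. -/
def AlmostContactMetricStructure.IsKenmotsu (A : AlmostContactMetricStructure m M) : Prop :=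
  ∀ e ∈ IsManifold.maximalAtlas (𝓡 m) ∞ M, ∀ u ∈ e.target, ∀ v w : EuclideanSpace ℝ (Fin m),
    Coord.covEndo (A.g.inChart e) (A.φ.inChart e) u v w =
      A.g.inChart e u (A.φ.inChart e u v) w • A.ζ.inChart e u
        - A.η.inChart e u w • A.φ.inChart e u v

/-- `L_V g + 2 α S = (2 lam - β r) g` for a function `lam` on `M`, in every smooth chart. -/
def RicciYamabeEquation (g : SmoothMetric m M) (V : SmoothVectorField m M) (lam : M → ℝ)
    (α β : ℝ) : Prop :=
  ∀ e ∈ IsManifold.maximalAtlas (𝓡 m) ∞ M, ∀ u ∈ e.target, ∀ v w : EuclideanSpace ℝ (Fin m),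
    Coord.lieMetric (g.inChart e) (V.inChart e) u v w + 2 * α * Coord.ricci (g.inChart e) u v w =
      (2 * lam (e.symm u) - β * Coord.scalarCurvature (g.inChart e) u) * g.inChart e u v w

/-- `(g, V, lam)` is an almost Ricci–Yamabe soliton of type `(α, β)`: `lam` is a smooth function. -/
def IsAlmostRicciYamabeSoliton (g : SmoothMetric m M) (V : SmoothVectorField m M) (lam : M → ℝ)
    (α β : ℝ) : Prop :=
  ContMDiff (𝓡 m) 𝓘(ℝ, ℝ) ∞ lam ∧ RicciYamabeEquation g V lam α β

/-- `(g, V, c)` is a Ricci–Yamabe soliton of type `(α, β)`: `c` is a real constant. -/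
def IsRicciYamabeSoliton (g : SmoothMetric m M) (V : SmoothVectorField m M) (c : ℝ)
    (α β : ℝ) : Prop :=
  RicciYamabeEquation g V (fun _ => c) α β

/-- The function `Hess_f(X, X)` is constant along the vector field `X`, that is,
`X (Hess_f(X, X)) = 0`, in every smooth chart. -/
def HessianConstantAlong (g : SmoothMetric m M) (f : M → ℝ) (X : SmoothVectorField m M) : Prop :=
  ∀ e ∈ IsManifold.maximalAtlas (𝓡 m) ∞ M, ∀ u ∈ e.target,
    fderiv ℝ (fun y => Coord.hessian (g.inChart e) (fun z => f (e.symm z)) y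
      (X.inChart e y) (X.inChart e y)) u (X.inChart e u) = 0

end Manifolds

end

/-!
The proof is local. A Kenmotsu manifold is locally a warped product `dt² + e^{2t} h` with `ζ = ∂_t`,
and in these terms the idea is as follows. Write `d = 2 n + 1` and `a = η(V)`. The components of the
soliton equation along `ζ` and across it say that `2 ζ(a) = 2 λ - β r + 2 α (d - 1)` and that the
part of `V` tangent to the leaves of `ker η` moves along `ζ` by minus the leafwise gradient of `a`.
Hence the derivative along `ζ` of the leafwise components expresses the leafwise Hessian of `a` by a
multiple of `h` and the Ricci tensor of `h`. The scalar curvature satisfies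
`ζ(r) = -2 (r + d (d - 1))`, so if `ζ³(λ) = 0`, then `a` is the sum of a polynomial `p` of degree at
most three in `t` and a multiple of `e^{-2t}`. Comparing the terms `t^k e^{2t}` in the Hessian
equation gives `p' = p''`, so `p' = 0`, and `p'` is the difference of `λ` and the constant of the theorem.

No adapted coordinates are used: the argument runs in an arbitrary chart, with derivatives along `ζ`
in place of derivatives in `t`.

* `IsLeviCivitaOn.isKenmotsuOn` extracts from the structure equations the only consequence needed,
  `∇_v ζ = v - η(v) ζ`. Then `η` is closed and `L_ζ g = 2 (g - η ⊗ η)`. The curvature operators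
  `R(x, y) ζ` and `R(y, ζ) w` are determined by `g` and `η`, and the second Bianchi identity gives
  `L_ζ S = -2 (d - 1) (g - η ⊗ η)` (`IsKenmotsuOn.lieForm_reeb_ricForm`). Its trace is the formula
  for `ζ(r)` (`IsKenmotsuOn.fderiv_trace_ricci_reeb`).
* The leafwise Hessian of a function `a` is replaced by `L_X g` on `ker η`, where `X` is the
  horizontal gradient of `a`. In that case `Y = [ζ, X] + 2 X` is the horizontal gradient of `ζ(a)`, and
  `L_ζ L_X g = L_Y g` (`IsKenmotsuOn.isHorizontalGradient_succ`, `IsKenmotsuOn.lieForm_succ`).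
  So all the fields needed arise from `ζ` and `V` by brackets.
* `IsKenmotsuOn.soliton_function_eq_zero` follows the forms `L_X g` through five derivatives along
  `ζ`. The function `ζ⁵(a) + 2 ζ⁴(a)` vanishes, which turns the resulting identity on `ker η` into a
  linear relation between `μ`, `ζ(μ)` and `ζ(ζ(μ))`, where `μ` is the difference of `λ` and the
  constant. Since `ζ³(μ) = 0`, this relation forces `μ = 0`.
-/

noncomputable section

set_option maxSynthPendingDepth 3

/-! ### Smooth charts and their differentials -/

section Charts

variable {m : ℕ} {M : Type*} [TopologicalSpace M] [ChartedSpace (EuclideanSpace ℝ (Fin m)) M]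
  {e : OpenPartialHomeomorph M (EuclideanSpace ℝ (Fin m))}

lemma mdifferentiable_of_mem_maximalAtlas (he : e ∈ IsManifold.maximalAtlas (𝓡 m) ∞ M) :
    e.MDifferentiable (𝓡 m) (𝓡 m) :=
  ⟨(contMDiffOn_of_mem_maximalAtlas he).mdifferentiableOn (by simp),
    (contMDiffOn_symm_of_mem_maximalAtlas he).mdifferentiableOn (by simp)⟩

lemma fromCoord_add (u v w : EuclideanSpace ℝ (Fin m)) :
    fromCoord e u (v + w) = fromCoord e u v + fromCoord e u w :=
  map_add (mfderiv (𝓡 m) (𝓡 m) e.symm u) v w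

lemma fromCoord_smul (c : ℝ) (u v : EuclideanSpace ℝ (Fin m)) :
    fromCoord e u (c • v) = c • fromCoord e u v :=
  map_smul (mfderiv (𝓡 m) (𝓡 m) e.symm u) c v

lemma toCoord_add (u : EuclideanSpace ℝ (Fin m)) (v w : TangentSpace (𝓡 m) (e.symm u)) :
    toCoord e u (v + w) = toCoord e u v + toCoord e u w :=
  map_add (mfderiv (𝓡 m) (𝓡 m) e (e.symm u)) v w

lemma toCoord_smul (c : ℝ) (u : EuclideanSpace ℝ (Fin m)) (v : TangentSpace (𝓡 m) (e.symm u)) :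
    toCoord e u (c • v) = c • toCoord e u v :=
  map_smul (mfderiv (𝓡 m) (𝓡 m) e (e.symm u)) c v

lemma toCoord_fromCoord (he : e ∈ IsManifold.maximalAtlas (𝓡 m) ∞ M)
    {u : EuclideanSpace ℝ (Fin m)} (hu : u ∈ e.target) (v : EuclideanSpace ℝ (Fin m)) :
    toCoord e u (fromCoord e u v) = v :=
  DFunLike.congr_fun ((mdifferentiable_of_mem_maximalAtlas he).comp_symm_deriv hu) v

lemma fromCoord_toCoord (he : e ∈ IsManifold.maximalAtlas (𝓡 m) ∞ M)
    {u : EuclideanSpace ℝ (Fin m)} (hu : u ∈ e.target) (v : TangentSpace (𝓡 m) (e.symm u)) :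
    fromCoord e u (toCoord e u v) = v := by
  have h := (mdifferentiable_of_mem_maximalAtlas he).symm_comp_deriv (e.map_target hu)
  have h2 := DFunLike.congr_fun h v
  simp only [fromCoord, toCoord]
  rw [e.right_inv hu] at h2
  exact h2

variable [IsManifold (𝓡 m) ∞ M]

/-- Coordinate vector fields are smooth. -/
lemma contMDiffOn_fromCoord (he : e ∈ IsManifold.maximalAtlas (𝓡 m) ∞ M)
    (v : EuclideanSpace ℝ (Fin m)) :
    ContMDiffOn (𝓡 m) ((𝓡 m).prod 𝓘(ℝ, EuclideanSpace ℝ (Fin m))) ∞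
      (fun u => Bundle.TotalSpace.mk' (EuclideanSpace ℝ (Fin m))
        (E := fun x : M => TangentSpace (𝓡 m) x) (e.symm u) (fromCoord e u v)) e.target := by
  have h1 := (contMDiffOn_symm_of_mem_maximalAtlas he).contMDiffOn_tangentMapWithin
    (m := ∞) (by simp) e.open_target.uniqueMDiffOn
  have h2 : ContMDiffOn (𝓡 m) ((𝓡 m).prod 𝓘(ℝ, EuclideanSpace ℝ (Fin m))) ∞
      (fun u => Bundle.TotalSpace.mk' (EuclideanSpace ℝ (Fin m))
        (E := fun x : EuclideanSpace ℝ (Fin m) => TangentSpace (𝓡 m) x) u v) e.target :=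
    contMDiffOn_vectorSpace_iff_contDiffOn.2 contDiffOn_const
  have h3 := h1.comp h2 (fun u hu => hu)
  refine h3.congr fun u hu => ?_
  simp only [Function.comp, tangentMapWithin, fromCoord]
  rw [mfderivWithin_of_isOpen e.open_target hu]

/-- A smooth field of tangent vectors along `e.symm` has smooth components in the chart `e`. -/
lemma contDiffOn_toCoord (he : e ∈ IsManifold.maximalAtlas (𝓡 m) ∞ M)
    {W : ∀ u : EuclideanSpace ℝ (Fin m), TangentSpace (𝓡 m) (e.symm u)}
    (hW : ContMDiffOn (𝓡 m) ((𝓡 m).prod 𝓘(ℝ, EuclideanSpace ℝ (Fin m))) ∞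
      (fun u => Bundle.TotalSpace.mk' (EuclideanSpace ℝ (Fin m))
        (E := fun x : M => TangentSpace (𝓡 m) x) (e.symm u) (W u)) e.target) :
    ContDiffOn ℝ ∞ (fun u => toCoord e u (W u)) e.target := by
  have h1 := (contMDiffOn_of_mem_maximalAtlas he).contMDiffOn_tangentMapWithin
    (m := ∞) (by simp) e.open_source.uniqueMDiffOn
  have h3 := h1.comp hW (fun u hu => e.map_target hu)
  refine contMDiffOn_vectorSpace_iff_contDiffOn.1 (h3.congr fun u hu => ?_)
  simp only [Function.comp, tangentMapWithin, toCoord]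
  rw [mfderivWithin_of_isOpen e.open_source (e.map_target hu), e.right_inv hu]

lemma SmoothMetric.contDiffOn_inChart (g : SmoothMetric m M)
    (he : e ∈ IsManifold.maximalAtlas (𝓡 m) ∞ M) (v w : EuclideanSpace ℝ (Fin m)) :
    ContDiffOn ℝ ∞ (fun u => g.inChart e u v w) e.target := by
  have h : ContMDiffOn (𝓡 m) ((𝓡 m).prod 𝓘(ℝ, ℝ)) ∞
      (fun u ↦ Bundle.TotalSpace.mk' ℝ (E := Bundle.Trivial M ℝ) (e.symm u)
        (g.inner (e.symm u) (fromCoord e u v) (fromCoord e u w))) e.target := by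
    apply ContMDiffOn.clm_bundle_apply₂ (F₁ := EuclideanSpace ℝ (Fin m))
      (F₂ := EuclideanSpace ℝ (Fin m))
    · exact g.contMDiff.comp_contMDiffOn (contMDiffOn_symm_of_mem_maximalAtlas he)
    · exact contMDiffOn_fromCoord he v
    · exact contMDiffOn_fromCoord he w
  rw [← contMDiffOn_iff_contDiffOn]
  intro u hu
  have := h u hu
  simp only [Bundle.contMDiffWithinAt_totalSpace] at this
  exact this.2

lemma SmoothVectorField.contDiffOn_inChart (V : SmoothVectorField m M)
    (he : e ∈ IsManifold.maximalAtlas (𝓡 m) ∞ M) :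
    ContDiffOn ℝ ∞ (V.inChart e) e.target :=
  contDiffOn_toCoord he
    (V.contMDiff.comp_contMDiffOn (contMDiffOn_symm_of_mem_maximalAtlas he))

lemma SmoothEndomorphism.contDiffOn_inChart (φ : SmoothEndomorphism m M)
    (he : e ∈ IsManifold.maximalAtlas (𝓡 m) ∞ M) (v : EuclideanSpace ℝ (Fin m)) :
    ContDiffOn ℝ ∞ (fun u => φ.inChart e u v) e.target := by
  refine contDiffOn_toCoord he ?_
  apply ContMDiffOn.clm_bundle_apply (F₁ := EuclideanSpace ℝ (Fin m))
    (E₁ := fun x : M => TangentSpace (𝓡 m) x) (E₂ := fun x : M => TangentSpace (𝓡 m) x)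
  · exact φ.contMDiff.comp_contMDiffOn (contMDiffOn_symm_of_mem_maximalAtlas he)
  · exact contMDiffOn_fromCoord he v

end Charts

/-! ### Metrics, connections and curvature in a normed space -/

namespace Coord

variable {E F : Type*} [NormedAddCommGroup E] [NormedSpace ℝ E] [NormedAddCommGroup F]
  [NormedSpace ℝ F] {U : Set E} {u : E}

lemma fderiv_apply_field {A : E → E →L[ℝ] F} {X : E → E}
    (hA : DifferentiableAt ℝ A u) (hX : DifferentiableAt ℝ X u) (z : E) :
    fderiv ℝ (fun y => A y (X y)) u z = fderiv ℝ A u z (X u) + A u (fderiv ℝ X u z) := by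
  rw [fderiv_clm_apply hA hX]
  simp [add_comm]

lemma fderiv_apply₂_field {T : E → E →L[ℝ] E →L[ℝ] F} {X Y : E → E}
    (hT : DifferentiableAt ℝ T u) (hX : DifferentiableAt ℝ X u) (hY : DifferentiableAt ℝ Y u)
    (z : E) :
    fderiv ℝ (fun y => T y (X y) (Y y)) u z =
      fderiv ℝ T u z (X u) (Y u) + T u (fderiv ℝ X u z) (Y u) + T u (X u) (fderiv ℝ Y u z) := by
  rw [fderiv_apply_field (hT.clm_apply hX) hY, fderiv_apply_field hT hX]
  simp

lemma fderiv_apply₂_const {T : E → E →L[ℝ] E →L[ℝ] F}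
    (hT : DifferentiableAt ℝ T u) (v w z : E) :
    fderiv ℝ (fun y => T y v w) u z = fderiv ℝ T u z v w := by
  simpa using fderiv_apply₂_field hT (differentiableAt_const v) (differentiableAt_const w) z

lemma fderiv_apply_const {A : E → E →L[ℝ] F}
    (hA : DifferentiableAt ℝ A u) (v z : E) :
    fderiv ℝ (fun y => A y v) u z = fderiv ℝ A u z v := by
  simpa using fderiv_apply_field hA (differentiableAt_const v) z

lemma fderiv_congr_of_eqOn (hU : IsOpen U) (hu : u ∈ U) {f h : E → F} (hfh : Set.EqOn f h U) :
    fderiv ℝ f u = fderiv ℝ h u :=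
  (hfh.eventuallyEq_of_mem (hU.mem_nhds hu)).fderiv_eq

lemma _root_.ContDiffOn.differentiableAt_of_isOpen (hU : IsOpen U) {f : E → F}
    (hf : ContDiffOn ℝ ∞ f U) (hu : u ∈ U) : DifferentiableAt ℝ f u :=
  (hf.contDiffAt (hU.mem_nhds hu)).differentiableAt (by simp)

lemma _root_.ContDiffOn.fderiv_infty (hU : IsOpen U) {f : E → F}
    (hf : ContDiffOn ℝ ∞ f U) : ContDiffOn ℝ ∞ (fderiv ℝ f) U :=
  hf.fderiv_of_isOpen hU (by simp)

lemma fderiv_fderiv_comm (hU : IsOpen U) {f : E → F} (hf : ContDiffOn ℝ ∞ f U) (hu : u ∈ U)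
    (v w : E) : fderiv ℝ (fderiv ℝ f) u v w = fderiv ℝ (fderiv ℝ f) u w v :=
  (hf.contDiffAt (hU.mem_nhds hu)).isSymmSndFDerivAt
    (by simpa using WithTop.coe_le_coe.2 (le_top : (2 : ℕ∞) ≤ ⊤)) v w

/-- `G` is a smooth Riemannian metric on the open set `U`. -/
structure IsMetricOn (G : E → E →L[ℝ] E →L[ℝ] ℝ) (U : Set (E)) : Prop where
  isOpen : IsOpen U
  smooth : ContDiffOn ℝ ∞ G U
  symm : ∀ u ∈ U, ∀ v w, G u v w = G u w v
  pos : ∀ u ∈ U, ∀ v, v ≠ 0 → 0 < G u v v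

variable {G : E → E →L[ℝ] E →L[ℝ] ℝ}

lemma IsMetricOn.ext (hG : IsMetricOn G U) (hu : u ∈ U) {v w : E}
    (h : ∀ z, G u v z = G u w z) : v = w := by
  by_contra hne
  have := hG.pos u hu (v - w) (sub_ne_zero.2 hne)
  simp [h] at this

/-- The bilinear map `(v, w) ↦ (z ↦ D_v(w, z) + D_w(v, z) - D_z(v, w))` of the Koszul formula. -/
def koszulForm (D : E →L[ℝ] E →L[ℝ] E →L[ℝ] ℝ) : E →ₗ[ℝ] E →ₗ[ℝ] E → ℝ :=
  LinearMap.mk₂ ℝ (fun v w z => D v w z + D w v z - D z v w)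
    (fun _ _ _ => funext fun _ => by simp only [map_add, add_apply, Pi.add_apply]; ring)
    (fun _ _ _ => funext fun _ => by
      simp only [map_smul, smul_apply, Pi.smul_apply, smul_eq_mul]; ring)
    (fun _ _ _ => funext fun _ => by simp only [map_add, add_apply, Pi.add_apply]; ring)
    (fun _ _ _ => funext fun _ => by
      simp only [map_smul, smul_apply, Pi.smul_apply, smul_eq_mul]; ring)

/-- The curvature `(D_x Γ)(y, z) + Γ(x, Γ(y, z)) - (D_y Γ)(x, z) - Γ(y, Γ(x, z))` of a connection
with Christoffel symbols `Γ`. -/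
def curv (Γ : E → E →L[ℝ] E →L[ℝ] E) (u x y z : E) : E :=
  fderiv ℝ Γ u x y z + Γ u x (Γ u y z) - fderiv ℝ Γ u y x z - Γ u y (Γ u x z)

variable {Γ : E → E →L[ℝ] E →L[ℝ] E}

lemma fderiv_curv (hU : IsOpen U) (hΓ : ContDiffOn ℝ ∞ Γ U) (hu : u ∈ U) (t x y z : E) :
    fderiv ℝ (fun p => curv Γ p x y z) u t =
      (fderiv ℝ (fderiv ℝ Γ) u t x y z + fderiv ℝ Γ u t x (Γ u y z) + Γ u x (fderiv ℝ Γ u t y z))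
      - (fderiv ℝ (fderiv ℝ Γ) u t y x z + fderiv ℝ Γ u t y (Γ u x z)
        + Γ u y (fderiv ℝ Γ u t x z)) := by
  have d0 := hΓ.differentiableAt_of_isOpen hU hu
  have d1 := (hΓ.fderiv_infty hU).differentiableAt_of_isOpen hU hu
  have dc : ∀ a b, DifferentiableAt ℝ (fun p => Γ p a b) u := fun a b =>
    (d0.clm_apply (differentiableAt_const a)).clm_apply (differentiableAt_const b)
  have e1 : ∀ a, DifferentiableAt ℝ (fun p => fderiv ℝ Γ p a) u := fun a =>
    d1.clm_apply (differentiableAt_const a)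
  have e2 : ∀ a b, DifferentiableAt ℝ (fun p => fderiv ℝ Γ p a b z) u := fun a b =>
    ((e1 a).clm_apply (differentiableAt_const b)).clm_apply (differentiableAt_const z)
  have e3 : ∀ a b, DifferentiableAt ℝ (fun p => Γ p a (Γ p b z)) u := fun a b =>
    (d0.clm_apply (differentiableAt_const a)).clm_apply (dc b z)
  have f2 : ∀ a b, fderiv ℝ (fun p => fderiv ℝ Γ p a b z) u t =
      fderiv ℝ (fderiv ℝ Γ) u t a b z := fun a b => by
    rw [fderiv_apply₂_const (e1 a), fderiv_apply_const d1]
  have f3 : ∀ a b, fderiv ℝ (fun p => Γ p a (Γ p b z)) u t =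
      fderiv ℝ Γ u t a (Γ u b z) + Γ u a (fderiv ℝ Γ u t b z) := fun a b => by
    rw [fderiv_apply₂_field d0 (differentiableAt_const a) (dc b z), fderiv_apply₂_const d0]
    simp
  have : fderiv ℝ (fun p => curv Γ p x y z) u =
      fderiv ℝ (fun p => fderiv ℝ Γ p x y z) u + fderiv ℝ (fun p => Γ p x (Γ p y z)) u
      - fderiv ℝ (fun p => fderiv ℝ Γ p y x z) u - fderiv ℝ (fun p => Γ p y (Γ p x z)) u := by
    have := ((((e2 x y).hasFDerivAt.add (e3 x y).hasFDerivAt).sub (e2 y x).hasFDerivAt).sub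
      (e3 y x).hasFDerivAt).fderiv
    exact this
  rw [this]
  simp only [sub_apply, add_apply, f2, f3]
  abel

/-- The second Bianchi identity, on constant vector fields. -/
lemma bianchi_second (hU : IsOpen U) (hΓ : ContDiffOn ℝ ∞ Γ U) (hu : u ∈ U) (t x y z : E) :
    (fderiv ℝ (fun p => curv Γ p x y z) u t + Γ u t (curv Γ u x y z) - curv Γ u x y (Γ u t z))
    + (fderiv ℝ (fun p => curv Γ p y t z) u x + Γ u x (curv Γ u y t z) - curv Γ u y t (Γ u x z))
    + (fderiv ℝ (fun p => curv Γ p t x z) u y + Γ u y (curv Γ u t x z) - curv Γ u t x (Γ u y z))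
      = 0 := by
  simp only [fderiv_curv hU hΓ hu]
  rw [fderiv_fderiv_comm hU hΓ hu t x, fderiv_fderiv_comm hU hΓ hu t y,
    fderiv_fderiv_comm hU hΓ hu x y]
  simp only [curv, map_add, map_sub]
  abel

lemma curv_antisymm (x y z : E) : curv Γ u x y z = - curv Γ u y x z := by
  simp only [curv]; abel

/-- `Γ` are the Christoffel symbols of the Levi-Civita connection of the metric `G` on `U`: they are
symmetric and the connection is metric. -/
structure IsLeviCivitaOn (G : E → E →L[ℝ] E →L[ℝ] ℝ) (Γ : E → E →L[ℝ] E →L[ℝ] E) (U : Set E) :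
    Prop extends IsMetricOn G U where
  smooth_chr : ContDiffOn ℝ ∞ Γ U
  chr_symm : ∀ u ∈ U, ∀ v w, Γ u v w = Γ u w v
  fderiv_eq : ∀ u ∈ U, ∀ z v w, fderiv ℝ G u z v w = G u (Γ u z v) w + G u v (Γ u z w)

lemma IsMetricOn.differentiableAt (hG : IsMetricOn G U) (hu : u ∈ U) : DifferentiableAt ℝ G u :=
  hG.smooth.differentiableAt_of_isOpen hG.isOpen hu

lemma IsLeviCivitaOn.differentiableAt_chr (hG : IsLeviCivitaOn G Γ U) (hu : u ∈ U) :
    DifferentiableAt ℝ Γ u :=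
  hG.smooth_chr.differentiableAt_of_isOpen hG.isOpen hu

lemma IsLeviCivitaOn.fderiv_chr_symm (hG : IsLeviCivitaOn G Γ U) (hu : u ∈ U) (z v w : E) :
    fderiv ℝ Γ u z v w = fderiv ℝ Γ u z w v := by
  rw [← fderiv_apply₂_const (hG.differentiableAt_chr hu),
    ← fderiv_apply₂_const (hG.differentiableAt_chr hu)]
  rw [fderiv_congr_of_eqOn hG.isOpen hu fun y hy => hG.chr_symm _ hy v w]

/-- The first Bianchi identity. -/
lemma IsLeviCivitaOn.bianchi_first (hG : IsLeviCivitaOn G Γ U) (hu : u ∈ U) (x y z : E) :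
    curv Γ u x y z + curv Γ u y z x + curv Γ u z x y = 0 := by
  simp only [curv]
  rw [hG.fderiv_chr_symm hu y z x, hG.fderiv_chr_symm hu z x y, hG.fderiv_chr_symm hu x y z,
    hG.chr_symm _ hu z x, hG.chr_symm _ hu y z, hG.chr_symm _ hu x y]
  abel

/-- `R(x, y)` is skew-adjoint, since second derivatives of the metric commute. -/
lemma IsLeviCivitaOn.curv_skew (hG : IsLeviCivitaOn G Γ U) (hu : u ∈ U) (x y z w : E) :
    G u (curv Γ u x y z) w = - G u (curv Γ u x y w) z := by
  have dG := hG.differentiableAt hu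
  have dΓ := hG.differentiableAt_chr hu
  have hf : ContDiffOn ℝ ∞ (fun p => G p z w) U :=
    (hG.smooth.clm_apply contDiffOn_const).clm_apply contDiffOn_const
  have dD := (hf.fderiv_infty hG.isOpen).differentiableAt_of_isOpen hG.isOpen hu
  have dc : ∀ a b, DifferentiableAt ℝ (fun p => Γ p a b) u := fun a b =>
    (dΓ.clm_apply (differentiableAt_const a)).clm_apply (differentiableAt_const b)
  -- differentiate `∂_b (G z w) = G(∇_b z, w) + G(z, ∇_b w)` in the direction `a`
  have key : ∀ a b, fderiv ℝ (fderiv ℝ fun p => G p z w) u a b =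
      G u (Γ u a (Γ u b z)) w + G u (Γ u b z) (Γ u a w)
      + G u (fderiv ℝ Γ u a b z) w
      + (G u (Γ u a z) (Γ u b w) + G u z (Γ u a (Γ u b w))
      + G u z (fderiv ℝ Γ u a b w)) := by
    intro a b
    have d1 : DifferentiableAt ℝ (fun p => G p (Γ p b z) w) u :=
      (dG.clm_apply (dc b z)).clm_apply (differentiableAt_const w)
    have d2 : DifferentiableAt ℝ (fun p => G p z (Γ p b w)) u :=
      (dG.clm_apply (differentiableAt_const z)).clm_apply (dc b w)
    rw [← fderiv_apply_const dD, fderiv_congr_of_eqOn hG.isOpen hu fun y hy =>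
        (fderiv_apply₂_const (hG.toIsMetricOn.differentiableAt hy) z w b).trans
          (hG.fderiv_eq _ hy b z w),
      fderiv_fun_add d1 d2, add_apply,
      fderiv_apply₂_field dG (dc b z) (differentiableAt_const w),
      fderiv_apply₂_field dG (differentiableAt_const z) (dc b w), hG.fderiv_eq _ hu,
      hG.fderiv_eq _ hu,
      fderiv_apply₂_const dΓ, fderiv_apply₂_const dΓ]
    simp
  have h2 := fderiv_fderiv_comm hG.isOpen hf hu x y
  rw [key, key] at h2
  rw [hG.symm u hu (curv _ _ _ _ w)]
  simp only [curv, map_add, map_sub, add_apply, sub_apply]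
  linarith

/-- The pair symmetry `g(R(x, y) z, w) = g(R(z, w) x, y)`. -/
lemma IsLeviCivitaOn.curv_pair (hG : IsLeviCivitaOn G Γ U) (hu : u ∈ U) (x y z w : E) :
    G u (curv Γ u x y z) w = G u (curv Γ u z w x) y := by
  have b : ∀ a b c d, G u (curv Γ u a b c) d + G u (curv Γ u b c a) d
      + G u (curv Γ u c a b) d = 0 := fun a b c d => by
    have := congrArg (fun v => G u v d) (hG.bianchi_first hu a b c)
    simpa using this
  have s := hG.curv_skew hu
  have t : ∀ a b c d, G u (curv Γ u a b c) d = - G u (curv Γ u b a c) d :=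
    fun a b c d => by rw [curv_antisymm]; simp
  have := b x y z w
  have := b y z w x
  have := b z w x y
  have := b w x y z
  linarith [s x y z w, s y z w x, s z w x y, s w x y z, s y z x w, s z x y w, s z w y x, s w y z x,
    s w x z y, s x z w y, s x y w z, s y w x z, t x z w y, t y w x z, t z x y w, t w y z x,
     t x y z w, t x y w z, t z w x y, t z w y x]

end Coord

/-! ### The Levi-Civita connection of a metric on `ℝ^m` -/

namespace Coord

variable {m : ℕ} {F : Type*} [NormedAddCommGroup F] [NormedSpace ℝ F]
  {U : Set (Space m)} {u : Space m}

lemma sum_apply_smul_basisVec (v : Space m) : ∑ i, v i • basisVec i = v := by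
  ext j
  simp [basisVec, Pi.single_apply]

/-- The continuous bilinear map with the coefficients `T u ∂_i ∂_j`. It agrees with `T u` when `T u`
is bilinear. -/
def bilinOf (T : Space m → Space m → Space m → F) (u : Space m) :
    Space m →L[ℝ] Space m →L[ℝ] F :=
  ∑ i, ∑ j, (EuclideanSpace.proj i : Space m →L[ℝ] ℝ).smulRight
    ((EuclideanSpace.proj j : Space m →L[ℝ] ℝ).smulRight (T u (basisVec i) (basisVec j)))

lemma bilinOf_apply {T : Space m → Space m → Space m → F} (L : Space m →ₗ[ℝ] Space m →ₗ[ℝ] F)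
    (hL : ∀ v w, T u v w = L v w) (v w : Space m) : bilinOf T u v w = T u v w := by
  conv_rhs => rw [hL, ← sum_apply_smul_basisVec v, ← sum_apply_smul_basisVec w]
  simp only [bilinOf, hL, sum_apply, ContinuousLinearMap.smulRight_apply, PiLp.proj_apply,
    smul_apply, map_sum, map_smul, LinearMap.sum_apply, LinearMap.smul_apply, Finset.smul_sum]
  rw [Finset.sum_comm]
  exact Finset.sum_congr rfl fun i _ => Finset.sum_congr rfl fun j _ => smul_comm _ _ _

lemma contDiffOn_bilinOf {T : Space m → Space m → Space m → F}
    (hT : ∀ i j, ContDiffOn ℝ ∞ (fun u => T u (basisVec i) (basisVec j)) U) :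
    ContDiffOn ℝ ∞ (bilinOf T) U := by
  unfold bilinOf
  refine ContDiffOn.sum fun i _ => ContDiffOn.sum fun j _ => ?_
  exact contDiffOn_const.smulRight (contDiffOn_const.smulRight (hT i j))

variable {G : Space m → Space m →L[ℝ] Space m →L[ℝ] ℝ}

lemma gram_apply (G : Space m → Space m →L[ℝ] Space m →L[ℝ] ℝ) (u : Space m) (i j : Fin m) :
    gram (fun u v w => G u v w) u i j = G u (basisVec i) (basisVec j) := rfl

lemma IsMetricOn.det_gram_ne_zero (hG : IsMetricOn G U) (hu : u ∈ U) :
    (gram (fun u v w => G u v w) u).det ≠ 0 := by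
  intro h
  obtain ⟨x, hx, h0⟩ := Matrix.exists_vecMul_eq_zero_iff.2 h
  set v : Space m := ∑ i, x i • basisVec i with hv
  have hvx : ∀ i, v i = x i := fun i => by simp [hv, basisVec, Pi.single_apply]
  have hv0 : v ≠ 0 := fun h' => hx (funext fun i => by rw [← hvx, h']; rfl)
  refine hv0 (hG.ext hu fun z => ?_)
  rw [← sum_apply_smul_basisVec z]
  simp only [map_sum, map_smul, map_zero, zero_apply, smul_eq_mul, mul_zero,
    Finset.sum_const_zero]
  refine Finset.sum_eq_zero fun j _ => ?_
  have := congrFun h0 j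
  simp only [Matrix.vecMul, dotProduct, gram_apply, Pi.zero_apply] at this
  simp [hv, this]

lemma contDiffOn_det {A : Space m → Matrix (Fin m) (Fin m) ℝ}
    (hA : ∀ i j, ContDiffOn ℝ ∞ (fun u => A u i j) U) : ContDiffOn ℝ ∞ (fun u => (A u).det) U := by
  simp only [Matrix.det_apply]
  refine ContDiffOn.sum fun σ _ => ContDiffOn.const_smul _ ?_
  exact contDiffOn_prod fun i _ => hA _ _

lemma contDiffOn_inv {A : Space m → Matrix (Fin m) (Fin m) ℝ}
    (hA : ∀ i j, ContDiffOn ℝ ∞ (fun u => A u i j) U) (h0 : ∀ u ∈ U, (A u).det ≠ 0)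
    (i j : Fin m) : ContDiffOn ℝ ∞ (fun u => (A u)⁻¹ i j) U := by
  simp only [Matrix.inv_def, Ring.inverse_eq_inv', Matrix.smul_apply, smul_eq_mul,
    Matrix.adjugate_apply]
  refine ((contDiffOn_det hA).inv h0).mul (contDiffOn_det fun k l => ?_)
  by_cases hk : k = j
  · subst hk
    simpa using contDiffOn_const
  · simpa [hk] using hA k l

lemma IsMetricOn.contDiffOn_gram (hG : IsMetricOn G U) (i j : Fin m) :
    ContDiffOn ℝ ∞ (fun u => gram (fun u v w => G u v w) u i j) U :=
  (hG.smooth.clm_apply contDiffOn_const).clm_apply contDiffOn_const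

/-- The Christoffel symbols of `G` as a field of continuous bilinear maps. -/
def chr (G : Space m → Space m →L[ℝ] Space m →L[ℝ] ℝ) :
    Space m → Space m →L[ℝ] Space m →L[ℝ] Space m :=
  bilinOf (christoffel fun u v w => G u v w)

lemma IsMetricOn.christoffel_apply (hG : IsMetricOn G U) (hu : u ∈ U) (v w : Space m) (k : Fin m) :
    christoffel (fun u v w => G u v w) u v w k = (1 / 2 : ℝ) * ∑ l,
      (gram (fun u v w => G u v w) u)⁻¹ k l * (fderiv ℝ G u v w (basisVec l)
        + fderiv ℝ G u w v (basisVec l) - fderiv ℝ G u (basisVec l) v w) := by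
  simp only [christoffel, fderiv_apply₂_const (hG.differentiableAt hu)]

lemma IsMetricOn.chr_apply (hG : IsMetricOn G U) (hu : u ∈ U) (v w : Space m) :
    chr G u v w = christoffel (fun u v w => G u v w) u v w := by
  -- raising the index `l` of the Koszul form is linear
  let A : (Space m → ℝ) →ₗ[ℝ] Space m :=
    { toFun := fun B => WithLp.toLp 2 fun k => (1 / 2 : ℝ) * ∑ l,
        (gram (fun u v w => G u v w) u)⁻¹ k l * B (basisVec l)
      map_add' := fun B C => by
        ext k
        simp only [Pi.add_apply, PiLp.add_apply, mul_add, Finset.sum_add_distrib]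
      map_smul' := fun r B => by
        ext k
        simp only [Pi.smul_apply, PiLp.smul_apply, smul_eq_mul, RingHom.id_apply, Finset.mul_sum]
        exact Finset.sum_congr rfl fun l _ => by ring }
  refine bilinOf_apply ((koszulForm (fderiv ℝ G u)).compr₂ A) (fun v w => ?_) v w
  ext k
  rw [hG.christoffel_apply hu]
  rfl

lemma IsMetricOn.contDiffOn_chr (hG : IsMetricOn G U) : ContDiffOn ℝ ∞ (chr G) U := by
  refine contDiffOn_bilinOf fun i j => contDiffOn_euclidean.2 fun k => ?_
  have hD := hG.smooth.fderiv_infty hG.isOpen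
  have hc : ∀ a b c : Space m, ContDiffOn ℝ ∞ (fun u => fderiv ℝ G u a b c) U := fun a b c =>
    ((hD.clm_apply contDiffOn_const).clm_apply contDiffOn_const).clm_apply contDiffOn_const
  refine ContDiffOn.congr ?_ fun u hu => hG.christoffel_apply hu _ _ k
  refine contDiffOn_const.mul (ContDiffOn.sum fun l _ => ContDiffOn.mul ?_ ?_)
  · exact contDiffOn_inv hG.contDiffOn_gram (fun u hu => hG.det_gram_ne_zero hu) k l
  · exact ((hc _ _ _).add (hc _ _ _)).sub (hc _ _ _)

/-- The Koszul formula. -/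
lemma IsMetricOn.koszul (hG : IsMetricOn G U) (hu : u ∈ U) (v w z : Space m) :
    G u (chr G u v w) z = (1 / 2 : ℝ) *
      (fderiv ℝ G u v w z + fderiv ℝ G u w v z - fderiv ℝ G u z v w) := by
  have key : ∀ l, G u (chr G u v w) (basisVec l) = (1 / 2 : ℝ) * (fderiv ℝ G u v w (basisVec l)
        + fderiv ℝ G u w v (basisVec l) - fderiv ℝ G u (basisVec l) v w) := by
    intro l
    set B : Fin m → ℝ := fun l => fderiv ℝ G u v w (basisVec l)
        + fderiv ℝ G u w v (basisVec l) - fderiv ℝ G u (basisVec l) v w with hB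
    set g := gram (fun u v w => G u v w) u with hg
    have h1 : g * g⁻¹ = 1 := Matrix.mul_nonsing_inv _ (isUnit_iff_ne_zero.2 (hG.det_gram_ne_zero hu))
    conv_lhs => rw [← sum_apply_smul_basisVec (chr G u v w)]
    simp only [map_sum, map_smul, sum_apply, smul_apply,
      smul_eq_mul, hG.chr_apply hu, hG.christoffel_apply hu]
    calc ∑ k, (1 / 2 : ℝ) * (∑ p, g⁻¹ k p * B p) * G u (basisVec k) (basisVec l)
        = (1 / 2 : ℝ) * (g.mulVec (g⁻¹.mulVec B)) l := by
          simp only [Matrix.mulVec, dotProduct]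
          rw [Finset.mul_sum]
          refine Finset.sum_congr rfl fun k _ => ?_
          rw [hG.symm u hu (basisVec k), hg, gram_apply]
          ring
      _ = (1 / 2 : ℝ) * B l := by rw [Matrix.mulVec_mulVec, h1, Matrix.one_mulVec]
  rw [← sum_apply_smul_basisVec z]
  simp only [map_sum, map_smul, sum_apply, smul_apply,
    smul_eq_mul, key]
  rw [← Finset.sum_add_distrib, ← Finset.sum_sub_distrib, Finset.mul_sum]
  exact Finset.sum_congr rfl fun l _ => by ring

lemma IsMetricOn.fderiv_symm (hG : IsMetricOn G U) (hu : u ∈ U) (z v w : Space m) :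
    fderiv ℝ G u z v w = fderiv ℝ G u z w v := by
  rw [← fderiv_apply₂_const (hG.differentiableAt hu), ← fderiv_apply₂_const (hG.differentiableAt hu)]
  rw [fderiv_congr_of_eqOn hG.isOpen hu fun y hy => hG.symm y hy v w]

lemma IsMetricOn.chr_symm (hG : IsMetricOn G U) (hu : u ∈ U) (v w : Space m) :
    chr G u v w = chr G u w v :=
  hG.ext hu fun z => by
    rw [hG.koszul hu, hG.koszul hu, hG.fderiv_symm hu z v w]
    ring

/-- The Levi-Civita connection is metric. -/
lemma IsMetricOn.fderiv_eq (hG : IsMetricOn G U) (hu : u ∈ U) (z v w : Space m) :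
    fderiv ℝ G u z v w = G u (chr G u z v) w + G u v (chr G u z w) := by
  rw [hG.symm u hu v, hG.koszul hu, hG.koszul hu, hG.fderiv_symm hu z w v,
    hG.fderiv_symm hu v z w, hG.fderiv_symm hu w z v]
  ring

lemma IsMetricOn.isLeviCivitaOn (hG : IsMetricOn G U) : IsLeviCivitaOn G (chr G) U :=
  { hG with
    smooth_chr := hG.contDiffOn_chr
    chr_symm := fun _ hu => hG.chr_symm hu
    fderiv_eq := fun _ hu => hG.fderiv_eq hu }

end Coord

/-! ### The Reeb field of a Kenmotsu manifold -/

namespace Coord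

variable {E : Type*} [NormedAddCommGroup E] [NormedSpace ℝ E] {U : Set E} {u : E}
  {G : E → E →L[ℝ] E →L[ℝ] ℝ} {Γ : E → E →L[ℝ] E →L[ℝ] E} {ζ : E → E}

/-- The part of the structure equations of a Kenmotsu manifold that only involves the metric `G`
(with Levi-Civita connection `Γ`) and the Reeb field `ζ`: it has unit length and
`∇_v ζ = v - η(v) ζ`. The form `η` is encoded as `G u (ζ u)`. -/
structure IsKenmotsuOn (G : E → E →L[ℝ] E →L[ℝ] ℝ) (Γ : E → E →L[ℝ] E →L[ℝ] E) (ζ : E → E)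
    (U : Set E) : Prop extends IsLeviCivitaOn G Γ U where
  smooth_reeb : ContDiffOn ℝ ∞ ζ U
  unit : ∀ u ∈ U, G u (ζ u) (ζ u) = 1
  cov_reeb : ∀ u ∈ U, ∀ v, fderiv ℝ ζ u v + Γ u v (ζ u) = v - G u (ζ u) v • ζ u

namespace IsLeviCivitaOn

/-- Kenmotsu's condition on `φ` determines the covariant derivative of the Reeb field. -/
lemma isKenmotsuOn (hG : IsLeviCivitaOn G Γ U) (hζ : ContDiffOn ℝ ∞ ζ U)
    (unit : ∀ u ∈ U, G u (ζ u) (ζ u) = 1) {Φ : E → E →L[ℝ] E} (hΦ : ContDiffOn ℝ ∞ Φ U)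
    (sq : ∀ u ∈ U, ∀ v, Φ u (Φ u v) = -v + G u v (ζ u) • ζ u)
    (compat : ∀ u ∈ U, ∀ v w, G u (Φ u v) (Φ u w) = G u v w - G u v (ζ u) * G u w (ζ u))
    (cov : ∀ u ∈ U, ∀ v w, fderiv ℝ Φ u v w + Γ u v (Φ u w) - Φ u (Γ u v w) =
      G u (Φ u v) w • ζ u - G u w (ζ u) • Φ u v) : IsKenmotsuOn G Γ ζ U := by
  refine { hG with smooth_reeb := hζ, unit := unit, cov_reeb := fun u hu v => ?_ }
  have dζ := hζ.differentiableAt_of_isOpen hG.isOpen hu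
  have Φζ : ∀ p ∈ U, Φ p (ζ p) = 0 := fun p hp => by
    by_contra hne
    have := hG.pos p hp _ hne
    rw [compat p hp, unit p hp] at this
    norm_num at this
  have ζne : ζ u ≠ 0 := fun h => by simpa [h] using unit u hu
  have ηΦ : ∀ w, G u (Φ u w) (ζ u) = 0 := fun w => by
    have h1 := sq u hu (Φ u w)
    rw [sq u hu w] at h1
    simp only [map_add, map_neg, map_smul, Φζ u hu, smul_zero, add_zero] at h1
    exact (smul_eq_zero.1 (left_eq_add.1 h1)).resolve_right ζne
  -- `∇_v ζ` has no component along `ζ`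
  have hη : G u (fderiv ℝ ζ u v + Γ u v (ζ u)) (ζ u) = 0 := by
    have h1 : fderiv ℝ (fun p => G p (ζ p) (ζ p)) u v = 0 := by
      rw [fderiv_congr_of_eqOn hG.isOpen hu (h := fun _ => (1 : ℝ)) unit]
      simp
    rw [fderiv_apply₂_field (hG.toIsMetricOn.differentiableAt hu) dζ dζ, hG.fderiv_eq u hu,
      hG.symm u hu (ζ u) (Γ u v (ζ u)), hG.symm u hu (ζ u) (fderiv ℝ ζ u v)] at h1
    rw [map_add, add_apply]
    linarith
  -- differentiate `φ ζ = 0`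
  have h2 : fderiv ℝ Φ u v (ζ u) + Φ u (fderiv ℝ ζ u v) = 0 := by
    rw [← fderiv_apply_field (hΦ.differentiableAt_of_isOpen hG.isOpen hu) dζ,
      fderiv_congr_of_eqOn hG.isOpen hu (h := fun _ => (0 : E)) Φζ]
    simp
  have h3 := cov u hu v (ζ u)
  rw [ηΦ, unit u hu, Φζ u hu, map_zero, eq_neg_of_add_eq_zero_left h2] at h3
  have h4 : Φ u (fderiv ℝ ζ u v + Γ u v (ζ u) - v) = 0 := by
    rw [map_sub, map_add]
    linear_combination (norm := module) (-1 : ℝ) • h3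
  have h5 := sq u hu (fderiv ℝ ζ u v + Γ u v (ζ u) - v)
  rw [h4, map_zero, map_sub, sub_apply, hη, zero_sub, hG.symm u hu v] at h5
  linear_combination (norm := module) h5

end IsLeviCivitaOn

namespace IsKenmotsuOn

lemma differentiableAt_reeb (hK : IsKenmotsuOn G Γ ζ U) (hu : u ∈ U) : DifferentiableAt ℝ ζ u :=
  hK.smooth_reeb.differentiableAt_of_isOpen hK.isOpen hu

lemma fderiv_reeb (hK : IsKenmotsuOn G Γ ζ U) (hu : u ∈ U) (v : E) :
    fderiv ℝ ζ u v = v - G u (ζ u) v • ζ u - Γ u v (ζ u) :=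
  eq_sub_of_add_eq (hK.cov_reeb u hu v)

lemma smooth_form (hK : IsKenmotsuOn G Γ ζ U) : ContDiffOn ℝ ∞ (fun p => G p (ζ p)) U :=
  hK.smooth.clm_apply hK.smooth_reeb

lemma differentiableAt_form (hK : IsKenmotsuOn G Γ ζ U) (hu : u ∈ U) :
    DifferentiableAt ℝ (fun p => G p (ζ p)) u :=
  hK.smooth_form.differentiableAt_of_isOpen hK.isOpen hu

/-- `(∇_x η)(y) = g(x, y) - η(x) η(y)`. -/
lemma fderiv_form (hK : IsKenmotsuOn G Γ ζ U) (hu : u ∈ U) (x y : E) :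
    fderiv ℝ (fun p => G p (ζ p)) u x y =
      G u (ζ u) (Γ u x y) + G u x y - G u (ζ u) x * G u (ζ u) y := by
  have dG := hK.toIsMetricOn.differentiableAt hu
  rw [fderiv_apply_field dG (hK.differentiableAt_reeb hu), add_apply, hK.fderiv_eq u hu,
    hK.fderiv_reeb hu]
  simp only [map_sub, map_smul, sub_apply, smul_apply, smul_eq_mul]
  ring

/-- The form `η` is closed. -/
lemma fderiv_form_symm (hK : IsKenmotsuOn G Γ ζ U) (hu : u ∈ U) (x y : E) :
    fderiv ℝ (fun p => G p (ζ p)) u x y = fderiv ℝ (fun p => G p (ζ p)) u y x := by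
  rw [hK.fderiv_form hu, hK.fderiv_form hu, hK.chr_symm u hu, hK.symm u hu x y]
  ring

lemma fderiv_form_const (hK : IsKenmotsuOn G Γ ζ U) (hu : u ∈ U) (x y : E) :
    fderiv ℝ (fun p => G p (ζ p) y) u x =
      G u (ζ u) (Γ u x y) + G u x y - G u (ζ u) x * G u (ζ u) y := by
  rw [fderiv_apply_const (hK.differentiableAt_form hu), hK.fderiv_form hu]

lemma fderiv_fderiv_reeb (hK : IsKenmotsuOn G Γ ζ U) (hu : u ∈ U) (x y : E) :
    fderiv ℝ (fderiv ℝ ζ) u x y =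
      - ((G u (ζ u) (Γ u x y) + G u x y - G u (ζ u) x * G u (ζ u) y) • ζ u
        + G u (ζ u) y • fderiv ℝ ζ u x) - (fderiv ℝ Γ u x y (ζ u) + Γ u y (fderiv ℝ ζ u x)) := by
  have dΓ := hK.differentiableAt_chr hu
  have dζ := hK.differentiableAt_reeb hu
  have dη := hK.differentiableAt_form hu
  have d1 : DifferentiableAt ℝ (fun p => G p (ζ p) y) u := dη.clm_apply (differentiableAt_const y)
  have d2 : DifferentiableAt ℝ (fun p => G p (ζ p) y • ζ p) u := d1.smul dζ
  have d3 : DifferentiableAt ℝ (fun p => Γ p y (ζ p)) u :=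
    (dΓ.clm_apply (differentiableAt_const y)).clm_apply dζ
  rw [← fderiv_apply_const
      ((hK.smooth_reeb.fderiv_infty hK.isOpen).differentiableAt_of_isOpen hK.isOpen hu),
    fderiv_congr_of_eqOn hK.isOpen hu fun p hp => hK.fderiv_reeb hp y,
    fderiv_fun_sub (d2.const_sub y) d3, sub_apply, fderiv_const_sub, neg_apply,
    fderiv_fun_smul d1 dζ, fderiv_apply₂_field dΓ (differentiableAt_const y) dζ, add_apply,
    smul_apply, ContinuousLinearMap.smulRight_apply, hK.fderiv_form_const hu]
  simp only [fderiv_fun_const, Pi.zero_apply, zero_apply, map_zero, add_zero]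
  abel

/-- `R(x, y) ζ = η(x) y - η(y) x`. -/
lemma curv_reeb (hK : IsKenmotsuOn G Γ ζ U) (hu : u ∈ U) (x y : E) :
    curv Γ u x y (ζ u) = G u (ζ u) x • y - G u (ζ u) y • x := by
  have h := fderiv_fderiv_comm hK.isOpen hK.smooth_reeb hu x y
  rw [hK.fderiv_fderiv_reeb hu, hK.fderiv_fderiv_reeb hu, hK.fderiv_reeb hu, hK.fderiv_reeb hu,
    hK.chr_symm u hu y x, hK.symm u hu y x] at h
  simp only [map_sub, map_smul] at h
  rw [hK.chr_symm u hu y x] at h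
  simp only [curv]
  linear_combination (norm := module) (-1 : ℝ) • h

/-- `R(y, ζ) w = g(y, w) ζ - η(w) y`. -/
lemma curv_reeb_right (hK : IsKenmotsuOn G Γ ζ U) (hu : u ∈ U) (y w : E) :
    curv Γ u y (ζ u) w = G u y w • ζ u - G u (ζ u) w • y := by
  refine hK.ext hu fun z => ?_
  rw [hK.curv_pair hu, hK.curv_skew hu, hK.curv_reeb hu]
  simp only [map_sub, map_smul, sub_apply, smul_apply, smul_eq_mul]
  rw [hK.symm u hu y w, hK.symm u hu y z]
  ring

end IsKenmotsuOn
end Coord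

/-! ### Lie derivatives and the Ricci tensor -/

namespace Coord

variable {E : Type*} [NormedAddCommGroup E] [NormedSpace ℝ E] {U : Set E} {u : E}
  {G : E → E →L[ℝ] E →L[ℝ] ℝ} {Γ : E → E →L[ℝ] E →L[ℝ] E} {ζ X Y : E → E}

section Lie

/-- The Lie derivative `L_X T` of a field `T` of bilinear forms. -/
def lieForm (X : E → E) (T : E → E →L[ℝ] E →L[ℝ] ℝ) (u : E) : E →L[ℝ] E →L[ℝ] ℝ :=
  fderiv ℝ T u (X u) + (T u).comp (fderiv ℝ X u) + ((T u).flip.comp (fderiv ℝ X u)).flip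

variable {T : E → E →L[ℝ] E →L[ℝ] ℝ}

lemma lieForm_apply (X : E → E) (T : E → E →L[ℝ] E →L[ℝ] ℝ) (u v w : E) :
    lieForm X T u v w =
      fderiv ℝ T u (X u) v w + T u (fderiv ℝ X u v) w + T u v (fderiv ℝ X u w) := rfl

lemma lieForm_congr (hU : IsOpen U) (hu : u ∈ U) {T' : E → E →L[ℝ] E →L[ℝ] ℝ}
    (h : Set.EqOn T T' U) : lieForm X T u = lieForm X T' u := by
  rw [lieForm, lieForm, fderiv_congr_of_eqOn hU hu h, h hu]

lemma contDiffOn_lieForm [FiniteDimensional ℝ E] (hU : IsOpen U) (hX : ContDiffOn ℝ ∞ X U)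
    (hT : ContDiffOn ℝ ∞ T U) : ContDiffOn ℝ ∞ (lieForm X T) U := by
  have hX' := hX.fderiv_infty hU
  refine contDiffOn_clm_apply.2 fun v => contDiffOn_clm_apply.2 fun w => ?_
  simp only [lieForm_apply]
  have hc : ∀ a : E, ContDiffOn ℝ ∞ (fun _ : E => a) U := fun a => contDiffOn_const
  exact ((((hT.fderiv_infty hU).clm_apply hX).clm_apply (hc v)).clm_apply (hc w)).add
    ((hT.clm_apply (hX'.clm_apply (hc v))).clm_apply (hc w)) |>.add
    ((hT.clm_apply (hc v)).clm_apply (hX'.clm_apply (hc w)))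

/-- `[L_X, L_Y] = L_{[X, Y]}`. -/
lemma lieForm_comm [FiniteDimensional ℝ E] (hU : IsOpen U) (hu : u ∈ U) (hX : ContDiffOn ℝ ∞ X U)
    (hY : ContDiffOn ℝ ∞ Y U) (hT : ContDiffOn ℝ ∞ T U) (v w : E) :
    lieForm X (lieForm Y T) u v w - lieForm Y (lieForm X T) u v w =
      lieForm (VectorField.lieBracket ℝ X Y) T u v w := by
  have key : ∀ {X Y : E → E}, ContDiffOn ℝ ∞ X U → ContDiffOn ℝ ∞ Y U →
      fderiv ℝ (lieForm Y T) u (X u) v w =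
        fderiv ℝ (fderiv ℝ T) u (X u) (Y u) v w + fderiv ℝ T u (fderiv ℝ Y u (X u)) v w
        + (fderiv ℝ T u (X u) (fderiv ℝ Y u v) w + T u (fderiv ℝ (fderiv ℝ Y) u (X u) v) w)
        + (fderiv ℝ T u (X u) v (fderiv ℝ Y u w) + T u v (fderiv ℝ (fderiv ℝ Y) u (X u) w)) := by
    intro X Y hX hY
    have dT := hT.differentiableAt_of_isOpen hU hu
    have dT' := (hT.fderiv_infty hU).differentiableAt_of_isOpen hU hu
    have dY := hY.differentiableAt_of_isOpen hU hu
    have dY' := (hY.fderiv_infty hU).differentiableAt_of_isOpen hU hu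
    have cv := differentiableAt_const (𝕜 := ℝ) (x := u) v
    have cw := differentiableAt_const (𝕜 := ℝ) (x := u) w
    have d1 := (dT'.clm_apply dY)
    have d1' := (d1.clm_apply cv).clm_apply cw
    have d2 := (dT.clm_apply (dY'.clm_apply cv)).clm_apply cw
    have d3 := (dT.clm_apply cv).clm_apply (dY'.clm_apply cw)
    rw [← fderiv_apply₂_const ((contDiffOn_lieForm hU hY hT).differentiableAt_of_isOpen hU hu)]
    simp only [lieForm_apply]
    rw [fderiv_fun_add (d1'.fun_add d2) d3, fderiv_fun_add d1' d2, add_apply, add_apply,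
      fderiv_apply₂_const d1, fderiv_apply_field dT' dY, fderiv_apply₂_field dT (dY'.clm_apply cv) cw,
      fderiv_apply₂_field dT cv (dY'.clm_apply cw), fderiv_apply_const dY', fderiv_apply_const dY']
    simp
  have hb : ∀ a, fderiv ℝ (VectorField.lieBracket ℝ X Y) u a =
      fderiv ℝ (fderiv ℝ Y) u a (X u) + fderiv ℝ Y u (fderiv ℝ X u a)
      - (fderiv ℝ (fderiv ℝ X) u a (Y u) + fderiv ℝ X u (fderiv ℝ Y u a)) := fun a => by
    have dX := hX.differentiableAt_of_isOpen hU hu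
    have dX' := (hX.fderiv_infty hU).differentiableAt_of_isOpen hU hu
    have dY := hY.differentiableAt_of_isOpen hU hu
    have dY' := (hY.fderiv_infty hU).differentiableAt_of_isOpen hU hu
    unfold VectorField.lieBracket
    rw [fderiv_fun_sub (dY'.clm_apply dX) (dX'.clm_apply dY), sub_apply,
      fderiv_apply_field dY' dX, fderiv_apply_field dX' dY]
  rw [lieForm_apply X, lieForm_apply Y (lieForm X T), key hX hY, key hY hX]
  simp only [lieForm_apply, hb]
  rw [fderiv_fderiv_comm hU hT hu (Y u), fderiv_fderiv_comm hU hY hu v,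
    fderiv_fderiv_comm hU hY hu w, fderiv_fderiv_comm hU hX hu v, fderiv_fderiv_comm hU hX hu w]
  simp only [VectorField.lieBracket, map_add, map_sub, add_apply, sub_apply]
  ring

end Lie

section Ricci

/-- The linear map `z ↦ R(z, v) w`. -/
def curvMap (Γ : E → E →L[ℝ] E →L[ℝ] E) (u v w : E) : E →L[ℝ] E :=
  ((fderiv ℝ Γ u).flip v).flip w + (Γ u).flip (Γ u v w) - (fderiv ℝ Γ u v).flip w
    - (Γ u v).comp ((Γ u).flip w)

lemma curvMap_apply (u v w z : E) : curvMap Γ u v w z = curv Γ u z v w := rfl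

lemma contDiffOn_curv (hU : IsOpen U) (hΓ : ContDiffOn ℝ ∞ Γ U) (x y z : E) :
    ContDiffOn ℝ ∞ (fun p => curv Γ p x y z) U := by
  have hc : ∀ a : E, ContDiffOn ℝ ∞ (fun _ : E => a) U := fun a => contDiffOn_const
  have h0 : ∀ a b, ContDiffOn ℝ ∞ (fun p => Γ p a b) U := fun a b =>
    (hΓ.clm_apply (hc a)).clm_apply (hc b)
  have h1 : ∀ a b, ContDiffOn ℝ ∞ (fun p => fderiv ℝ Γ p a b z) U := fun a b =>
    (((hΓ.fderiv_infty hU).clm_apply (hc a)).clm_apply (hc b)).clm_apply (hc z)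
  have h2 : ∀ a b, ContDiffOn ℝ ∞ (fun p => Γ p a (Γ p b z)) U := fun a b =>
    (hΓ.clm_apply (hc a)).clm_apply (h0 b z)
  exact (((h1 x y).add (h2 x y)).sub (h1 y x)).sub (h2 y x)

lemma contDiffOn_curvMap [FiniteDimensional ℝ E] (hU : IsOpen U) (hΓ : ContDiffOn ℝ ∞ Γ U)
    (v w : E) : ContDiffOn ℝ ∞ (fun p => curvMap Γ p v w) U :=
  contDiffOn_clm_apply.2 fun z => contDiffOn_curv hU hΓ z v w

/-- The trace of continuous endomorphisms, as a continuous linear form. -/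
def traceL (E : Type*) [NormedAddCommGroup E] [NormedSpace ℝ E] [FiniteDimensional ℝ E] :
    (E →L[ℝ] E) →L[ℝ] ℝ :=
  LinearMap.toContinuousLinearMap ((LinearMap.trace ℝ E).comp (ContinuousLinearMap.coeLM ℝ))

variable [FiniteDimensional ℝ E]

lemma traceL_apply (A : E →L[ℝ] E) : traceL E A = LinearMap.trace ℝ E A := rfl

lemma traceL_id : traceL E (ContinuousLinearMap.id ℝ E) = Module.finrank ℝ E :=
  LinearMap.trace_id ℝ E

lemma traceL_smulRight (f : E →L[ℝ] ℝ) (x : E) : traceL E (f.smulRight x) = f x :=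
  LinearMap.trace_smulRight (f : E →ₗ[ℝ] ℝ) x

lemma traceL_comp_comm (A B : E →L[ℝ] E) : traceL E (A.comp B) = traceL E (B.comp A) :=
  LinearMap.trace_comp_comm' (B : E →ₗ[ℝ] E) (A : E →ₗ[ℝ] E)

/-- The Ricci tensor `S(v, w) = trace (z ↦ R(z, v) w)` as a field of bilinear forms. -/
def ricForm (Γ : E → E →L[ℝ] E →L[ℝ] E) (u : E) : E →L[ℝ] E →L[ℝ] ℝ :=
  LinearMap.toContinuousLinearMap
    ((LinearMap.toContinuousLinearMap : (E →ₗ[ℝ] ℝ) ≃ₗ[ℝ] (E →L[ℝ] ℝ)).toLinearMap.comp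
      (LinearMap.mk₂ ℝ (fun v w => traceL E (curvMap Γ u v w))
        (fun _ _ _ => by
          rw [← map_add]; congr 1; ext
          simp only [curvMap_apply, curv, add_apply, map_add]; abel)
        (fun _ _ _ => by
          rw [← map_smul]; congr 1; ext
          simp only [curvMap_apply, curv, smul_apply, map_smul, smul_sub, smul_add])
        (fun _ _ _ => by
          rw [← map_add]; congr 1; ext
          simp only [curvMap_apply, curv, add_apply, map_add]; abel)
        (fun _ _ _ => by
          rw [← map_smul]; congr 1; ext
          simp only [curvMap_apply, curv, smul_apply, map_smul, smul_sub, smul_add])))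

lemma ricForm_apply (u v w : E) : ricForm Γ u v w = traceL E (curvMap Γ u v w) := rfl

lemma contDiffOn_ricForm (hU : IsOpen U) (hΓ : ContDiffOn ℝ ∞ Γ U) :
    ContDiffOn ℝ ∞ (ricForm Γ) U :=
  contDiffOn_clm_apply.2 fun v => contDiffOn_clm_apply.2 fun w =>
    (traceL E).contDiff.comp_contDiffOn (contDiffOn_curvMap hU hΓ v w)

namespace IsKenmotsuOn

/-- `S(v, ζ) = -(d - 1) η(v)` in dimension `d`. -/
lemma ricForm_reeb_right (hK : IsKenmotsuOn G Γ ζ U) (hu : u ∈ U) (v : E) :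
    ricForm Γ u v (ζ u) = -(Module.finrank ℝ E - 1) * G u (ζ u) v := by
  have : curvMap Γ u v (ζ u) =
      (G u (ζ u)).smulRight v - G u (ζ u) v • ContinuousLinearMap.id ℝ E := by
    ext z
    rw [curvMap_apply, hK.curv_reeb hu]
    rfl
  rw [ricForm_apply, this, map_sub, map_smul, traceL_smulRight, traceL_id, smul_eq_mul]
  ring

lemma ricForm_reeb_left (hK : IsKenmotsuOn G Γ ζ U) (hu : u ∈ U) (w : E) :
    ricForm Γ u (ζ u) w = -(Module.finrank ℝ E - 1) * G u (ζ u) w := by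
  have : curvMap Γ u (ζ u) w =
      (G u w).smulRight (ζ u) - G u (ζ u) w • ContinuousLinearMap.id ℝ E := by
    ext z
    rw [curvMap_apply, hK.curv_reeb_right hu, hK.symm u hu z w]
    rfl
  rw [ricForm_apply, this, map_sub, map_smul, traceL_smulRight, traceL_id, smul_eq_mul,
    hK.symm u hu w]
  ring

/-- The Lie derivative of the curvature along the Reeb field, computed with the second Bianchi
identity. -/
lemma fderiv_curv_reeb (hK : IsKenmotsuOn G Γ ζ U) (hu : u ∈ U) (z v w : E) :
    fderiv ℝ (fun p => curv Γ p z v w) u (ζ u) =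
      - Γ u (ζ u) (curv Γ u z v w) + curv Γ u z v (Γ u (ζ u) w) - curv Γ u (fderiv ℝ ζ u z) v w
      - curv Γ u z (fderiv ℝ ζ u v) w
      + (G u v w • (G u (ζ u) z • ζ u - (2 : ℝ) • z) + G u z w • ((2 : ℝ) • v - G u (ζ u) v • ζ u)
        + G u (ζ u) w • (G u (ζ u) v • z - G u (ζ u) z • v)) := by
  have dG := hK.toIsMetricOn.differentiableAt hu
  have dζ := hK.differentiableAt_reeb hu
  -- differentiate `R(ζ, y) w = η(w) y - g(y, w) ζ` in the direction `x`
  have key : ∀ x y, fderiv ℝ (fun p => curv Γ p (ζ u) y w) u x =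
      (G u (ζ u) (Γ u x w) + G u x w - G u (ζ u) x * G u (ζ u) w) • y
      - ((G u (Γ u x y) w + G u y (Γ u x w)) • ζ u + G u y w • fderiv ℝ ζ u x)
      - curv Γ u (fderiv ℝ ζ u x) y w := by
    intro x y
    have dM := (contDiffOn_curvMap hK.isOpen hK.smooth_chr y w).differentiableAt_of_isOpen
      hK.isOpen hu
    have h1 := fderiv_apply_field dM dζ x
    have h2 : Set.EqOn (fun p => curvMap Γ p y w (ζ p)) (fun p => G p (ζ p) w • y - G p y w • ζ p)
        U := fun p hp => by
      simp only [curvMap_apply]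
      rw [curv_antisymm, hK.curv_reeb_right hp, neg_sub]
    have d1 : DifferentiableAt ℝ (fun p => G p (ζ p) w) u :=
      (hK.differentiableAt_form hu).clm_apply (differentiableAt_const w)
    have d2 : DifferentiableAt ℝ (fun p => G p y w) u :=
      (dG.clm_apply (differentiableAt_const y)).clm_apply (differentiableAt_const w)
    rw [fderiv_congr_of_eqOn hK.isOpen hu h2, fderiv_fun_sub (d1.smul_const y) (d2.fun_smul dζ),
      sub_apply, fderiv_smul_const d1, fderiv_fun_smul d2 dζ, ← fderiv_apply_const dM] at h1
    simp only [ContinuousLinearMap.smulRight_apply, add_apply, smul_apply, curvMap_apply,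
      fderiv_apply₂_const dG, hK.fderiv_form_const hu, hK.fderiv_eq u hu] at h1
    rw [← sub_eq_of_eq_add h1]
    abel
  have hB := bianchi_second hK.isOpen hK.smooth_chr hu (ζ u) z v w
  have h3 : ∀ a b c, curv Γ u a b c = - curv Γ u b a c := fun a b c => curv_antisymm a b c
  have h4 : fderiv ℝ (fun p => curv Γ p v (ζ u) w) u z =
      - fderiv ℝ (fun p => curv Γ p (ζ u) v w) u z := by
    have : (fun p => curv Γ p v (ζ u) w) = fun p => - curv Γ p (ζ u) v w :=
      funext fun p => curv_antisymm _ _ _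
    rw [this, fderiv_fun_neg, neg_apply]
  rw [h4, key, key, h3 (ζ u) z w, h3 (ζ u) z (Γ u v w), hK.curv_reeb_right hu,
    hK.curv_reeb_right hu, hK.curv_reeb_right hu, hK.curv_reeb_right hu,
    h3 (fderiv ℝ ζ u v) z w] at hB
  simp only [hK.fderiv_reeb hu z, hK.fderiv_reeb hu v, map_sub, map_smul, map_neg] at hB ⊢
  rw [hK.chr_symm u hu v z] at hB
  linear_combination (norm := module) hB

/-- `L_ζ S = -2 (d - 1) (g - η ⊗ η)` in dimension `d`. -/
lemma lieForm_reeb_ricForm (hK : IsKenmotsuOn G Γ ζ U) (hu : u ∈ U) (v w : E) :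
    lieForm ζ (ricForm Γ) u v w =
      -2 * (Module.finrank ℝ E - 1) * (G u v w - G u (ζ u) v * G u (ζ u) w) := by
  have dM := (contDiffOn_curvMap hK.isOpen hK.smooth_chr v w).differentiableAt_of_isOpen
    hK.isOpen hu
  have dS := (contDiffOn_ricForm hK.isOpen hK.smooth_chr).differentiableAt_of_isOpen hK.isOpen hu
  have h1 : fderiv ℝ (ricForm Γ) u (ζ u) v w =
      traceL E (fderiv ℝ (fun p => curvMap Γ p v w) u (ζ u)) := by
    rw [← fderiv_apply₂_const dS]
    exact DFunLike.congr_fun ((traceL E).hasFDerivAt.comp u dM.hasFDerivAt).fderiv (ζ u)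
  have h2 : fderiv ℝ (fun p => curvMap Γ p v w) u (ζ u) =
      -(Γ u (ζ u)).comp (curvMap Γ u v w) + curvMap Γ u v (Γ u (ζ u) w) - curvMap Γ u v w
      + (G u (ζ u)).smulRight (curvMap Γ u v w (ζ u)) + (curvMap Γ u v w).comp (Γ u (ζ u))
      - curvMap Γ u (fderiv ℝ ζ u v) w
      + (G u v w • ((G u (ζ u)).smulRight (ζ u) - (2 : ℝ) • ContinuousLinearMap.id ℝ E)
        + (G u w).smulRight ((2 : ℝ) • v - G u (ζ u) v • ζ u)
        + G u (ζ u) w • (G u (ζ u) v • ContinuousLinearMap.id ℝ E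
          - (G u (ζ u)).smulRight v)) := by
    ext z
    rw [← fderiv_apply_const dM]
    simp only [curvMap_apply, add_apply, sub_apply, neg_apply, smul_apply,
      ContinuousLinearMap.comp_apply, ContinuousLinearMap.smulRight_apply,
      ContinuousLinearMap.id_apply, hK.fderiv_curv_reeb hu]
    have h3 : curv Γ u (fderiv ℝ ζ u z) v w =
        curv Γ u z v w - G u (ζ u) z • curv Γ u (ζ u) v w - curv Γ u (Γ u (ζ u) z) v w := by
      simp only [← curvMap_apply, hK.fderiv_reeb hu, map_sub, map_smul]
      rw [hK.chr_symm u hu z]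
    rw [h3, hK.symm u hu w z]
    module
  rw [lieForm_apply, h1, h2]
  simp only [map_add, map_sub, map_neg, map_smul, traceL_smulRight, traceL_id, ← ricForm_apply,
    smul_eq_mul, traceL_comp_comm (curvMap Γ u v w), curvMap_apply]
  rw [curv_antisymm, hK.curv_reeb_right hu, hK.fderiv_reeb hu w]
  simp only [map_sub, map_neg, map_smul, smul_eq_mul, hK.ricForm_reeb_right hu,
    hK.unit u hu]
  rw [hK.chr_symm u hu w, hK.symm u hu w (ζ u), hK.symm u hu w v]
  ring

end IsKenmotsuOn
end Ricci
end Coord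

/-! ### The metric and the scalar curvature along the Reeb field -/

namespace Coord

section
variable {E : Type*} [NormedAddCommGroup E] [NormedSpace ℝ E] {U : Set E} {u : E}
  {G : E → E →L[ℝ] E →L[ℝ] ℝ} {Γ : E → E →L[ℝ] E →L[ℝ] E} {ζ : E → E}

namespace IsKenmotsuOn

/-- `L_ζ g = 2 (g - η ⊗ η)`. -/
lemma lieForm_reeb_metric (hK : IsKenmotsuOn G Γ ζ U) (hu : u ∈ U) (v w : E) :
    lieForm ζ G u v w = 2 * (G u v w - G u (ζ u) v * G u (ζ u) w) := by
  rw [lieForm_apply, hK.fderiv_eq u hu, hK.fderiv_reeb hu, hK.fderiv_reeb hu,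
    hK.chr_symm u hu v, hK.chr_symm u hu w]
  simp only [map_sub, map_smul, sub_apply, smul_apply, smul_eq_mul]
  rw [hK.symm u hu v (ζ u)]
  ring

variable [FiniteDimensional ℝ E]

/-- `ζ r = -2 (r + d (d - 1))` for the scalar curvature `r = trace Q`, where `Q` is the Ricci
operator and `d` the dimension. -/
lemma fderiv_trace_ricci_reeb (hK : IsKenmotsuOn G Γ ζ U) (hu : u ∈ U) {Q : E → E →L[ℝ] E}
    (hQ : ContDiffOn ℝ ∞ Q U) (h : ∀ p ∈ U, ∀ v w, G p (Q p v) w = ricForm Γ p w v) :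
    fderiv ℝ (fun p => traceL E (Q p)) u (ζ u) =
      -2 * (traceL E (Q u) + Module.finrank ℝ E * (Module.finrank ℝ E - 1)) := by
  have dG := hK.toIsMetricOn.differentiableAt hu
  have dQ := hQ.differentiableAt_of_isOpen hK.isOpen hu
  have dS := (contDiffOn_ricForm hK.isOpen hK.smooth_chr).differentiableAt_of_isOpen hK.isOpen hu
  have h1 : fderiv ℝ (fun p => traceL E (Q p)) u (ζ u) = traceL E (fderiv ℝ Q u (ζ u)) :=
    DFunLike.congr_fun ((traceL E).hasFDerivAt.comp u dQ.hasFDerivAt).fderiv (ζ u)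
  -- the Lie derivative of `Q` along `ζ`
  have h2 : fderiv ℝ Q u (ζ u) = (fderiv ℝ ζ u).comp (Q u) - (Q u).comp (fderiv ℝ ζ u)
      - (2 * (Module.finrank ℝ E - 1 : ℝ)) •
        (ContinuousLinearMap.id ℝ E - (G u (ζ u)).smulRight (ζ u))
      - (2 : ℝ) • (Q u - ((G u (ζ u)).comp (Q u)).smulRight (ζ u)) := by
    ext v
    refine hK.ext hu fun w => ?_
    have hS := hK.lieForm_reeb_ricForm hu w v
    have hg := hK.lieForm_reeb_metric hu (Q u v) w
    have hd : fderiv ℝ (fun p => G p (Q p v) w) u (ζ u) = fderiv ℝ (ricForm Γ) u (ζ u) w v := by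
      rw [fderiv_congr_of_eqOn hK.isOpen hu fun p hp => h p hp v w, fderiv_apply₂_const dS]
    rw [fderiv_apply₂_field dG (dQ.clm_apply (differentiableAt_const v)) (differentiableAt_const w),
      fderiv_apply_const dQ] at hd
    rw [lieForm_apply] at hS hg
    rw [← h u hu, ← h u hu] at hS
    simp only [fderiv_fun_const, Pi.zero_apply, zero_apply, map_zero, add_zero] at hd
    simp only [sub_apply, smul_apply, ContinuousLinearMap.comp_apply,
      ContinuousLinearMap.smulRight_apply, ContinuousLinearMap.id_apply, map_sub, map_smul,
      smul_eq_mul]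
    rw [hK.symm u hu w v] at hS
    linarith
  have h3 : G u (ζ u) (Q u (ζ u)) = -(Module.finrank ℝ E - 1) := by
    rw [hK.symm u hu, h u hu, hK.ricForm_reeb_right hu, hK.unit u hu, mul_one]
  rw [h1, h2]
  simp only [map_sub, map_smul, traceL_smulRight, traceL_id, smul_eq_mul,
    traceL_comp_comm (fderiv ℝ ζ u), ContinuousLinearMap.comp_apply, hK.unit u hu, h3]
  ring

end IsKenmotsuOn
end

variable {m : ℕ} {U : Set (Space m)} {u : Space m} {G : Space m → Space m →L[ℝ] Space m →L[ℝ] ℝ}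

lemma IsMetricOn.cov_const (hG : IsMetricOn G U) (hu : u ∈ U) (v w : Space m) :
    cov (fun u v w => G u v w) (fun _ => v) (fun _ => w) u = chr G u v w := by
  simp [cov, hG.chr_apply hu]

lemma IsMetricOn.cov_cov_const (hG : IsMetricOn G U) (hu : u ∈ U) (x y z : Space m) :
    cov (fun u v w => G u v w) (fun _ => x)
      (cov (fun u v w => G u v w) (fun _ => y) (fun _ => z)) u =
      fderiv ℝ (chr G) u x y z + chr G u x (chr G u y z) := by
  rw [cov, fderiv_congr_of_eqOn hG.isOpen hu fun p hp => hG.cov_const hp y z, hG.cov_const hu,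
    hG.chr_apply hu x, fderiv_apply₂_const (hG.isLeviCivitaOn.differentiableAt_chr hu)]

lemma IsMetricOn.curvature_const (hG : IsMetricOn G U) (hu : u ∈ U) (x y z : Space m) :
    curvature (fun u v w => G u v w) (fun _ => x) (fun _ => y) (fun _ => z) u =
      curv (chr G) u x y z := by
  have h0 : cov (fun u v w => G u v w)
      (VectorField.lieBracket ℝ (fun _ : Space m => x) (fun _ => y)) (fun _ => z) u = 0 := by
    have : VectorField.lieBracket ℝ (fun _ : Space m => x) (fun _ => y) = fun _ => 0 := by
      funext p
      simp [VectorField.lieBracket]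
    rw [this, hG.cov_const hu]
    simp
  rw [curvature, h0, hG.cov_cov_const hu, hG.cov_cov_const hu, curv]
  abel

lemma sum_apply_basisVec_eq_traceL (A : Space m →L[ℝ] Space m) :
    ∑ i, A (basisVec i) i = traceL (Space m) A := by
  rw [traceL_apply, LinearMap.trace_eq_sum_inner _ (EuclideanSpace.basisFun (Fin m) ℝ)]
  simp [basisVec, EuclideanSpace.inner_single_left]

lemma IsMetricOn.ricci_eq (hG : IsMetricOn G U) (hu : u ∈ U) (v w : Space m) :
    ricci (fun u v w => G u v w) u v w = ricForm (chr G) u v w := by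
  simp only [ricci, hG.curvature_const hu, ← curvMap_apply]
  rw [sum_apply_basisVec_eq_traceL, ricForm_apply]

/-- The Ricci operator, obtained from the Ricci tensor by raising an index. -/
def ricciOp (G : Space m → Space m →L[ℝ] Space m →L[ℝ] ℝ) (u : Space m) : Space m →L[ℝ] Space m :=
  ∑ i, ∑ j, (gram (fun u v w => G u v w) u)⁻¹ i j •
    (ricForm (chr G) u (basisVec i)).smulRight (basisVec j)

lemma IsMetricOn.scalarCurvature_eq (hG : IsMetricOn G U) (hu : u ∈ U) :
    scalarCurvature (fun u v w => G u v w) u = traceL (Space m) (ricciOp G u) := by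
  simp only [scalarCurvature, ricciOp, hG.ricci_eq hu, map_sum, map_smul, traceL_smulRight,
    smul_eq_mul]

lemma IsMetricOn.contDiffOn_ricciOp (hG : IsMetricOn G U) : ContDiffOn ℝ ∞ (ricciOp G) U := by
  refine ContDiffOn.sum fun i _ => ContDiffOn.sum fun j _ => ContDiffOn.fun_smul ?_ ?_
  · exact contDiffOn_inv hG.contDiffOn_gram (fun u hu => hG.det_gram_ne_zero hu) i j
  · exact ((contDiffOn_ricForm hG.isOpen hG.contDiffOn_chr).clm_apply contDiffOn_const).smulRight
      contDiffOn_const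

lemma IsMetricOn.inner_ricciOp (hG : IsMetricOn G U) (hu : u ∈ U) (v w : Space m) :
    G u (ricciOp G u v) w = ricForm (chr G) u w v := by
  set g := gram (fun u v w => G u v w) u with hg
  have h1 : g⁻¹ * g = 1 := Matrix.nonsing_inv_mul _ (isUnit_iff_ne_zero.2 (hG.det_gram_ne_zero hu))
  have key : ∀ k, G u (ricciOp G u v) (basisVec k) = ricForm (chr G) u (basisVec k) v := fun k => by
    have h2 : ∀ i, ∑ j, g⁻¹ i j * G u (basisVec j) (basisVec k) = if i = k then 1 else 0 :=
      fun i => by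
        have := congrFun (congrFun h1 i) k
        rwa [Matrix.mul_apply, Matrix.one_apply] at this
    simp only [ricciOp, ← hg, sum_apply, smul_apply, ContinuousLinearMap.smulRight_apply, map_sum,
      map_smul, smul_eq_mul]
    calc ∑ i, ∑ j, g⁻¹ i j * (ricForm (chr G) u (basisVec i) v * G u (basisVec j) (basisVec k))
        = ∑ i, ricForm (chr G) u (basisVec i) v *
            ∑ j, g⁻¹ i j * G u (basisVec j) (basisVec k) := by
          refine Finset.sum_congr rfl fun i _ => ?_
          rw [Finset.mul_sum]
          exact Finset.sum_congr rfl fun j _ => by ring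
      _ = ricForm (chr G) u (basisVec k) v := by simp [h2]
  rw [← sum_apply_smul_basisVec w]
  simp only [map_sum, map_smul, sum_apply, smul_apply, key]

end Coord

/-! ### Horizontal gradients and forms -/

namespace Coord

variable {E : Type*} [NormedAddCommGroup E] [NormedSpace ℝ E] {U : Set E} {u : E}
  {G : E → E →L[ℝ] E →L[ℝ] ℝ} {Γ : E → E →L[ℝ] E →L[ℝ] E} {ζ X Y V : E → E}

section Linearity

variable {T S : E → E →L[ℝ] E →L[ℝ] ℝ}

lemma lieForm_add_smul (hT : DifferentiableAt ℝ T u) (hS : DifferentiableAt ℝ S u) (c : ℝ)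
    (v w : E) : lieForm X (fun p => T p + c • S p) u v w =
      lieForm X T u v w + c * lieForm X S u v w := by
  simp only [lieForm_apply]
  rw [fderiv_fun_add hT (hS.fun_const_smul c), fderiv_fun_const_smul hS]
  simp only [add_apply, smul_apply, smul_eq_mul]
  ring

lemma lieForm_fun_smul {f : E → ℝ} (hf : DifferentiableAt ℝ f u) (hT : DifferentiableAt ℝ T u)
    (v w : E) : lieForm X (fun p => f p • T p) u v w =
      fderiv ℝ f u (X u) * T u v w + f u * lieForm X T u v w := by
  simp only [lieForm_apply]
  rw [fderiv_fun_smul hf hT]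
  simp only [add_apply, smul_apply, smul_eq_mul, ContinuousLinearMap.smulRight_apply]
  ring

lemma lieForm_add_smul_field (hX : DifferentiableAt ℝ X u) (hY : DifferentiableAt ℝ Y u) (c : ℝ)
    (v w : E) : lieForm (fun p => X p + c • Y p) T u v w =
      lieForm X T u v w + c * lieForm Y T u v w := by
  simp only [lieForm_apply]
  rw [fderiv_fun_add hX (hY.fun_const_smul c), fderiv_fun_const_smul hY]
  simp only [add_apply, smul_apply, map_add, map_smul, smul_eq_mul]
  ring

lemma lieForm_fun_smul_field {f : E → ℝ} (hf : DifferentiableAt ℝ f u)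
    (hX : DifferentiableAt ℝ X u) (v w : E) : lieForm (fun p => f p • X p) T u v w =
      f u * lieForm X T u v w + fderiv ℝ f u v * T u (X u) w + fderiv ℝ f u w * T u v (X u) := by
  simp only [lieForm_apply]
  rw [fderiv_fun_smul hf hX]
  simp only [add_apply, smul_apply, map_add, map_smul, smul_eq_mul,
    ContinuousLinearMap.smulRight_apply]
  ring

end Linearity

/-- The derivative of the function `f` along the vector field `X`. -/
def dirDeriv (X : E → E) (f : E → ℝ) (u : E) : ℝ := fderiv ℝ f u (X u)

lemma contDiffOn_dirDeriv (hU : IsOpen U) (hX : ContDiffOn ℝ ∞ X U) {f : E → ℝ}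
    (hf : ContDiffOn ℝ ∞ f U) : ContDiffOn ℝ ∞ (dirDeriv X f) U :=
  (hf.fderiv_infty hU).clm_apply hX

lemma dirDeriv_congr (hU : IsOpen U) {f h : E → ℝ} (hfh : Set.EqOn f h U) :
    Set.EqOn (dirDeriv X f) (dirDeriv X h) U := fun p hp => by
  rw [dirDeriv, dirDeriv, fderiv_congr_of_eqOn hU hp hfh]

lemma dirDeriv_add_smul {f h : E → ℝ} (hf : DifferentiableAt ℝ f u) (hh : DifferentiableAt ℝ h u)
    (c : ℝ) : dirDeriv X (fun p => f p + c * h p) u = dirDeriv X f u + c * dirDeriv X h u := by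
  rw [dirDeriv, fderiv_fun_add hf (hh.const_mul c), fderiv_const_mul hh]
  rfl

lemma contDiffOn_lieBracket (hU : IsOpen U) (hX : ContDiffOn ℝ ∞ X U) (hY : ContDiffOn ℝ ∞ Y U) :
    ContDiffOn ℝ ∞ (VectorField.lieBracket ℝ X Y) U :=
  ((hY.fderiv_infty hU).clm_apply hX).sub ((hX.fderiv_infty hU).clm_apply hY)

/-- The square `η ⊗ η` of the form `η = g(ζ, ·)`. -/
def formSq (G : E → E →L[ℝ] E →L[ℝ] ℝ) (ζ : E → E) (u : E) : E →L[ℝ] E →L[ℝ] ℝ :=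
  (G u (ζ u)).smulRight (G u (ζ u))

lemma formSq_apply (u v w : E) : formSq G ζ u v w = G u (ζ u) v * G u (ζ u) w := rfl

/-- `T` agrees with `c g` on the horizontal distribution `ker η`; the sign of the function `c` is
arbitrary. -/
def IsHorizontallyConformal (G : E → E →L[ℝ] E →L[ℝ] ℝ) (ζ : E → E) (U : Set E)
    (T : E → E →L[ℝ] E →L[ℝ] ℝ) (c : E → ℝ) : Prop :=
  ∀ u ∈ U, ∀ v w, G u (ζ u) v = 0 → G u (ζ u) w = 0 → T u v w = c u * G u v w

/-- `X` is the horizontal gradient of `a`, that is, `g(X, ·) = da - ζ(a) η`. -/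
structure IsHorizontalGradient (G : E → E →L[ℝ] E →L[ℝ] ℝ) (ζ : E → E) (U : Set E)
    (a : E → ℝ) (X : E → E) : Prop where
  smooth_fun : ContDiffOn ℝ ∞ a U
  smooth : ContDiffOn ℝ ∞ X U
  eq : ∀ u ∈ U, ∀ y, G u (X u) y = fderiv ℝ a u y - dirDeriv ζ a u * G u (ζ u) y

/-- The field `[ζ, X] + 2 X`. It is the horizontal gradient of `ζ(a)` when `X` is that of `a`. -/
def nextField (ζ X : E → E) (p : E) : E := VectorField.lieBracket ℝ ζ X p + (2 : ℝ) • X p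

namespace IsKenmotsuOn

lemma smooth_formSq (hK : IsKenmotsuOn G Γ ζ U) : ContDiffOn ℝ ∞ (formSq G ζ) U :=
  hK.smooth_form.smulRight hK.smooth_form

/-- `L_X η = d(η(X))`, since `η` is closed. -/
lemma fderiv_form_apply (hK : IsKenmotsuOn G Γ ζ U) (hu : u ∈ U) (hX : ContDiffOn ℝ ∞ X U)
    (y : E) : fderiv ℝ (fun p => G p (ζ p) (X p)) u y =
      fderiv ℝ (fun p => G p (ζ p)) u (X u) y + G u (ζ u) (fderiv ℝ X u y) := by
  rw [fderiv_apply_field (hK.differentiableAt_form hu)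
    (hX.differentiableAt_of_isOpen hK.isOpen hu), hK.fderiv_form_symm hu]

/-- `L_ζ η = 0`. -/
lemma lie_reeb_form (hK : IsKenmotsuOn G Γ ζ U) (hu : u ∈ U) (y : E) :
    fderiv ℝ (fun p => G p (ζ p)) u (ζ u) y + G u (ζ u) (fderiv ℝ ζ u y) = 0 := by
  rw [← hK.fderiv_form_apply hu hK.smooth_reeb,
    fderiv_congr_of_eqOn hK.isOpen hu (h := fun _ => (1 : ℝ)) hK.unit]
  simp

lemma lieForm_formSq (hK : IsKenmotsuOn G Γ ζ U) (hu : u ∈ U) (hX : ContDiffOn ℝ ∞ X U) (v w : E) :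
    lieForm X (formSq G ζ) u v w =
      fderiv ℝ (fun p => G p (ζ p) (X p)) u v * G u (ζ u) w
        + G u (ζ u) v * fderiv ℝ (fun p => G p (ζ p) (X p)) u w := by
  have d0 := hK.differentiableAt_form hu
  have d1 : ∀ a, DifferentiableAt ℝ (fun p => G p (ζ p) a) u := fun a =>
    d0.clm_apply (differentiableAt_const a)
  rw [lieForm_apply, ← fderiv_apply₂_const (hK.smooth_formSq.differentiableAt_of_isOpen hK.isOpen hu)]
  simp only [formSq_apply]
  rw [fderiv_fun_mul (d1 v) (d1 w), hK.fderiv_form_apply hu hX, hK.fderiv_form_apply hu hX]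
  simp only [add_apply, smul_apply, smul_eq_mul, fderiv_apply_const d0]
  ring

lemma lieForm_reeb_metric_eqOn (hK : IsKenmotsuOn G Γ ζ U) :
    Set.EqOn (lieForm ζ G) (fun p => (2 : ℝ) • (G p + (-1 : ℝ) • formSq G ζ p)) U := fun p hp => by
  ext v w
  rw [hK.lieForm_reeb_metric hp]
  simp only [smul_apply, add_apply, formSq_apply, smul_eq_mul]
  ring

/-- `L_X L_ζ g = 2 L_X g - 2 L_X (η ⊗ η)`. -/
lemma lieForm_lieForm_reeb_metric (hK : IsKenmotsuOn G Γ ζ U) (hu : u ∈ U) (v w : E) :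
    lieForm X (lieForm ζ G) u v w = 2 * lieForm X G u v w - 2 * lieForm X (formSq G ζ) u v w := by
  have dG := hK.toIsMetricOn.differentiableAt hu
  have dq := hK.smooth_formSq.differentiableAt_of_isOpen hK.isOpen hu
  rw [lieForm_congr hK.isOpen hu hK.lieForm_reeb_metric_eqOn,
    lieForm_fun_smul (differentiableAt_const (2 : ℝ)) (dG.fun_add (dq.fun_const_smul (-1 : ℝ))),
    lieForm_add_smul dG dq]
  simp only [fderiv_fun_const, Pi.zero_apply, zero_apply]
  ring

/-- Taking the Lie derivative along `ζ` preserves the forms conformal to `g` on `ker η`. -/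
lemma isHorizontallyConformal_lieForm (hK : IsKenmotsuOn G Γ ζ U) {T : E → E →L[ℝ] E →L[ℝ] ℝ}
    {c : E → ℝ} (hT : ContDiffOn ℝ ∞ T U) (hc : ContDiffOn ℝ ∞ c U)
    (h : IsHorizontallyConformal G ζ U T c) :
    IsHorizontallyConformal G ζ U (lieForm ζ T) (fun p => dirDeriv ζ c p + 2 * c p) := by
  intro u hu v w hv hw
  have dG := hK.toIsMetricOn.differentiableAt hu
  have dT := hT.differentiableAt_of_isOpen hK.isOpen hu
  have dc := hc.differentiableAt_of_isOpen hK.isOpen hu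
  have dη := hK.differentiableAt_form hu
  have dζ := hK.differentiableAt_reeb hu
  -- the horizontal fields extending `v` and `w`
  have de : ∀ a, DifferentiableAt ℝ (fun p => a - G p (ζ p) a • ζ p) u := fun a =>
    (differentiableAt_const a).fun_sub ((dη.clm_apply (differentiableAt_const a)).fun_smul dζ)
  have hor : ∀ p ∈ U, ∀ a, G p (ζ p) (a - G p (ζ p) a • ζ p) = 0 := fun p hp a => by
    rw [map_sub, map_smul, hK.unit p hp, smul_eq_mul, mul_one, sub_self]
  have fe : ∀ a, G u (ζ u) a = 0 → fderiv ℝ (fun p => a - G p (ζ p) a • ζ p) u (ζ u) =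
      G u (ζ u) (fderiv ℝ ζ u a) • ζ u := fun a ha => by
    have h1 : DifferentiableAt ℝ (fun p => G p (ζ p) a) u :=
      dη.clm_apply (differentiableAt_const a)
    rw [fderiv_const_sub, fderiv_fun_smul h1 dζ, neg_apply, add_apply, smul_apply,
      ContinuousLinearMap.smulRight_apply, fderiv_apply_const dη, ha, zero_smul, zero_add,
      ← neg_smul, neg_eq_of_add_eq_zero_right (hK.lie_reeb_form hu a)]
  -- differentiate the vanishing of `D = T - c g` on these fields along `ζ`
  set D : E → E →L[ℝ] E →L[ℝ] ℝ := fun p => T p + (-1 : ℝ) • (c p • G p) with hD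
  have dD : DifferentiableAt ℝ D u := dT.fun_add ((dc.fun_smul dG).fun_const_smul _)
  have D0 : ∀ p ∈ U, ∀ a b, G p (ζ p) a = 0 → G p (ζ p) b = 0 → D p a b = 0 :=
    fun p hp a b ha hb => by
      simp only [hD, add_apply, smul_apply, smul_eq_mul, h p hp a b ha hb]
      ring
  have h1 : fderiv ℝ (fun p => D p (v - G p (ζ p) v • ζ p) (w - G p (ζ p) w • ζ p)) u (ζ u) = 0 := by
    rw [fderiv_congr_of_eqOn hK.isOpen hu (h := fun _ => (0 : ℝ))
      fun p hp => D0 p hp _ _ (hor p hp v) (hor p hp w)]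
    simp
  rw [fderiv_apply₂_field dD (de v) (de w), fe v hv, fe w hw, hv, hw] at h1
  simp only [zero_smul, sub_zero] at h1
  have h2 : D u (fderiv ℝ ζ u v) w = D u (G u (ζ u) (fderiv ℝ ζ u v) • ζ u) w := by
    have := D0 u hu _ _ (hor u hu (fderiv ℝ ζ u v)) hw
    rwa [map_sub, sub_apply, sub_eq_zero] at this
  have h3 : D u v (fderiv ℝ ζ u w) = D u v (G u (ζ u) (fderiv ℝ ζ u w) • ζ u) := by
    have := D0 u hu _ _ hv (hor u hu (fderiv ℝ ζ u w))
    rwa [map_sub, sub_eq_zero] at this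
  have h4 : lieForm ζ D u v w = 0 := by
    rw [lieForm_apply, h2, h3, h1]
  rw [hD, lieForm_add_smul dT (dc.fun_smul dG), lieForm_fun_smul dc dG, hK.lieForm_reeb_metric hu,
    hv] at h4
  simp only [dirDeriv]
  linarith

/-- If `X` is the horizontal gradient of `a`, then `[ζ, X] + 2 X` is the horizontal gradient of
`ζ(a)`. -/
lemma isHorizontalGradient_succ (hK : IsKenmotsuOn G Γ ζ U) {a : E → ℝ}
    (h : IsHorizontalGradient G ζ U a X) :
    IsHorizontalGradient G ζ U (dirDeriv ζ a) (nextField ζ X) := by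
  have sa := contDiffOn_dirDeriv hK.isOpen hK.smooth_reeb h.smooth_fun
  refine ⟨sa, (contDiffOn_lieBracket hK.isOpen hK.smooth_reeb h.smooth).add
    (contDiffOn_const.smul h.smooth), fun u hu y => ?_⟩
  have dG := hK.toIsMetricOn.differentiableAt hu
  have dX := h.smooth.differentiableAt_of_isOpen hK.isOpen hu
  have dη := hK.differentiableAt_form hu
  have dζ := hK.differentiableAt_reeb hu
  have da' := (h.smooth_fun.fderiv_infty hK.isOpen).differentiableAt_of_isOpen hK.isOpen hu
  have dsa := sa.differentiableAt_of_isOpen hK.isOpen hu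
  have ηX : G u (ζ u) (X u) = 0 := by
    rw [hK.symm u hu, h.eq u hu, hK.unit u hu, dirDeriv]
    ring
  have h1 : fderiv ℝ (fun p => G p (X p) y) u (ζ u) =
      fderiv ℝ (fderiv ℝ a) u (ζ u) y - (dirDeriv ζ (dirDeriv ζ a) u * G u (ζ u) y
        + dirDeriv ζ a u * fderiv ℝ (fun p => G p (ζ p)) u (ζ u) y) := by
    have d1 : DifferentiableAt ℝ (fun p => G p (ζ p) y) u :=
      dη.clm_apply (differentiableAt_const y)
    rw [fderiv_congr_of_eqOn hK.isOpen hu fun p hp => h.eq p hp y,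
      fderiv_fun_sub (da'.clm_apply (differentiableAt_const y)) (dsa.fun_mul d1), sub_apply,
      fderiv_apply_const da', fderiv_fun_mul dsa d1, add_apply, smul_apply, smul_apply,
      fderiv_apply_const dη, smul_eq_mul, smul_eq_mul, dirDeriv.eq_1 ζ (dirDeriv ζ a)]
    ring
  have h2 : fderiv ℝ (dirDeriv ζ a) u y =
      fderiv ℝ (fderiv ℝ a) u (ζ u) y + fderiv ℝ a u (fderiv ℝ ζ u y) := by
    unfold dirDeriv
    rw [fderiv_apply_field da' dζ, fderiv_fderiv_comm hK.isOpen h.smooth_fun hu]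
  have h3 := hK.lieForm_reeb_metric hu (X u) y
  rw [ηX, lieForm_apply, h.eq u hu (fderiv ℝ ζ u y)] at h3
  rw [fderiv_apply₂_field dG dX (differentiableAt_const y)] at h1
  simp only [fderiv_fun_const, Pi.zero_apply, zero_apply, map_zero, add_zero] at h1
  have h4 := hK.lie_reeb_form hu y
  simp only [nextField, VectorField.lieBracket, map_add, map_sub, map_smul, add_apply, sub_apply,
    smul_apply, smul_eq_mul]
  rw [h2]
  linear_combination h1 - h3 - dirDeriv ζ a u * h4

variable [FiniteDimensional ℝ E]

/-- `L_ζ L_X g = L_Y g` for `Y = [ζ, X] + 2 X`, when `X` is horizontal. -/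
lemma lieForm_succ (hK : IsKenmotsuOn G Γ ζ U) {a : E → ℝ} (h : IsHorizontalGradient G ζ U a X) :
    Set.EqOn (lieForm ζ (lieForm X G)) (lieForm (nextField ζ X) G) U := by
  intro u hu
  ext v w
  have ηX : Set.EqOn (fun p => G p (ζ p) (X p)) (fun _ => (0 : ℝ)) U := fun p hp => by
    simp only
    rw [hK.symm p hp, h.eq p hp, hK.unit p hp, dirDeriv]
    ring
  have h1 := lieForm_comm hK.isOpen hu hK.smooth_reeb h.smooth hK.smooth v w
  rw [hK.lieForm_lieForm_reeb_metric hu, hK.lieForm_formSq hu h.smooth,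
    fderiv_congr_of_eqOn hK.isOpen hu ηX] at h1
  unfold nextField
  rw [lieForm_add_smul_field ((contDiffOn_lieBracket hK.isOpen hK.smooth_reeb
    h.smooth).differentiableAt_of_isOpen hK.isOpen hu)
    (h.smooth.differentiableAt_of_isOpen hK.isOpen hu), ← h1]
  simp

end IsKenmotsuOn
end Coord

/-! ### The soliton equation on a coordinate domain -/

namespace Coord

variable {E : Type*} [NormedAddCommGroup E] [NormedSpace ℝ E] {U : Set E} {u : E}
  {G : E → E →L[ℝ] E →L[ℝ] ℝ} {Γ : E → E →L[ℝ] E →L[ℝ] E} {ζ V : E → E} {α : ℝ}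
  {f : E → ℝ}

/-- The field `ζ(η(V)) ζ - [ζ, V]`, the horizontal gradient of `η(V)` when `V` is the vector field of
a soliton. -/
def solitonField (G : E → E →L[ℝ] E →L[ℝ] ℝ) (ζ V : E → E) (p : E) : E :=
  dirDeriv ζ (fun p => G p (ζ p) (V p)) p • ζ p + (-1 : ℝ) • VectorField.lieBracket ℝ ζ V p

namespace IsKenmotsuOn

/-- `g([ζ, V], y) = (L_V g)(ζ, y) - d(η(V))(y)`. -/
lemma inner_lieBracket_reeb (hK : IsKenmotsuOn G Γ ζ U) (hu : u ∈ U) (hV : ContDiffOn ℝ ∞ V U)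
    (y : E) : G u (VectorField.lieBracket ℝ ζ V u) y =
      lieForm V G u (ζ u) y - fderiv ℝ (fun p => G p (ζ p) (V p)) u y := by
  rw [hK.fderiv_form_apply hu hV, fderiv_apply_field (hK.toIsMetricOn.differentiableAt hu)
    (hK.differentiableAt_reeb hu), lieForm_apply]
  simp only [VectorField.lieBracket, map_sub, sub_apply, add_apply]
  ring

variable {μ ρ : E → ℝ}

/-- If the third derivative of `μ` along `ζ` vanishes, the span of `μ`, `ζ(μ)`, `ζ(ζ(μ))` is
invariant under `ζ`. -/
lemma dirDeriv_combination (hK : IsKenmotsuOn G Γ ζ U) (hμ : ContDiffOn ℝ ∞ μ U)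
    (h3 : ∀ u ∈ U, dirDeriv ζ (dirDeriv ζ (dirDeriv ζ μ)) u = 0) (x y z : ℝ) (hu : u ∈ U) :
    dirDeriv ζ (fun p => x * μ p + y * dirDeriv ζ μ p + z * dirDeriv ζ (dirDeriv ζ μ) p) u =
      x * dirDeriv ζ μ u + y * dirDeriv ζ (dirDeriv ζ μ) u := by
  have s1 := contDiffOn_dirDeriv hK.isOpen hK.smooth_reeb hμ
  have s2 := contDiffOn_dirDeriv hK.isOpen hK.smooth_reeb s1
  have d0 := hμ.differentiableAt_of_isOpen hK.isOpen hu
  have d1 := s1.differentiableAt_of_isOpen hK.isOpen hu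
  have d2 := s2.differentiableAt_of_isOpen hK.isOpen hu
  rw [dirDeriv_add_smul ((d0.const_mul x).fun_add (d1.const_mul y)) d2,
    dirDeriv_add_smul (d0.const_mul x) d1, h3 u hu, dirDeriv, fderiv_const_mul d0]
  simp [dirDeriv]

lemma eq_zero_of_combination (hK : IsKenmotsuOn G Γ ζ U) (hμ : ContDiffOn ℝ ∞ μ U)
    (h3 : ∀ u ∈ U, dirDeriv ζ (dirDeriv ζ (dirDeriv ζ μ)) u = 0) {x y z : ℝ} (hx : x ≠ 0)
    (h : ∀ u ∈ U, x * μ u + y * dirDeriv ζ μ u + z * dirDeriv ζ (dirDeriv ζ μ) u = 0)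
    (hu : u ∈ U) : μ u = 0 := by
  have step : ∀ {x y z : ℝ},
      (∀ u ∈ U, x * μ u + y * dirDeriv ζ μ u + z * dirDeriv ζ (dirDeriv ζ μ) u = 0) →
      ∀ u ∈ U, 0 * μ u + x * dirDeriv ζ μ u + y * dirDeriv ζ (dirDeriv ζ μ) u = 0 := by
    intro x y z h p hp
    have h1 := hK.dirDeriv_combination hμ h3 x y z hp
    rw [dirDeriv_congr hK.isOpen (h := fun _ => 0) h hp] at h1
    simp only [dirDeriv, fderiv_fun_const, Pi.zero_apply, zero_apply] at h1 ⊢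
    linarith
  have e1 := step h u hu
  have e2 := step (step h) u hu
  have m2 : dirDeriv ζ (dirDeriv ζ μ) u = 0 := by simpa [hx] using e2
  have m1 : dirDeriv ζ μ u = 0 := by simpa [hx, m2] using e1
  simpa [hx, m1, m2] using h u hu

variable [FiniteDimensional ℝ E]

/-- In a soliton with `L_V g + 2 α S = f g`, one has `2 ζ(η(V)) = f + 2 α (d - 1)`. -/
lemma two_mul_dirDeriv_form (hK : IsKenmotsuOn G Γ ζ U) (hV : ContDiffOn ℝ ∞ V U)
    (hsol : ∀ u ∈ U, ∀ v w, lieForm V G u v w + 2 * α * ricForm Γ u v w = f u * G u v w)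
    (hu : u ∈ U) : 2 * dirDeriv ζ (fun p => G p (ζ p) (V p)) u =
      f u + 2 * α * (Module.finrank ℝ E - 1) := by
  have h1 := hK.inner_lieBracket_reeb hu hV (ζ u)
  have h2 := hsol u hu (ζ u) (ζ u)
  rw [hK.ricForm_reeb_left hu, hK.unit u hu] at h2
  have h3 : G u (VectorField.lieBracket ℝ ζ V u) (ζ u) =
      dirDeriv ζ (fun p => G p (ζ p) (V p)) u := by
    have h4 := hK.lie_reeb_form hu (V u)
    rw [hK.symm u hu, dirDeriv, hK.fderiv_form_apply hu hV, hK.fderiv_form_symm hu]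
    simp only [VectorField.lieBracket, map_sub]
    linear_combination -h4
  rw [h3] at h1
  simp only [dirDeriv] at h1 ⊢
  linarith

/-- In a soliton, `ζ(a) ζ - [ζ, V]` is the horizontal gradient of `a = η(V)`. -/
lemma isHorizontalGradient_soliton (hK : IsKenmotsuOn G Γ ζ U) (hV : ContDiffOn ℝ ∞ V U)
    (hsol : ∀ u ∈ U, ∀ v w, lieForm V G u v w + 2 * α * ricForm Γ u v w = f u * G u v w) :
    IsHorizontalGradient G ζ U (fun p => G p (ζ p) (V p))
      (solitonField G ζ V) := by
  have sa : ContDiffOn ℝ ∞ (fun p => G p (ζ p) (V p)) U := hK.smooth_form.clm_apply hV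
  refine ⟨sa, ((contDiffOn_dirDeriv hK.isOpen hK.smooth_reeb sa).smul hK.smooth_reeb).add
    (contDiffOn_const.smul (contDiffOn_lieBracket hK.isOpen hK.smooth_reeb hV)), fun u hu y => ?_⟩
  have h1 := hK.two_mul_dirDeriv_form hV hsol hu
  have h2 := hsol u hu (ζ u) y
  rw [hK.ricForm_reeb_left hu] at h2
  rw [solitonField, map_add, add_apply, map_smul, map_smul, smul_apply, smul_apply,
    hK.inner_lieBracket_reeb hu hV, smul_eq_mul, smul_eq_mul]
  linear_combination (-1) * h2 + G u (ζ u) y * h1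

/-- The soliton equation on `ker η`, differentiated once along `ζ`: it expresses the Hessian of
`a = η(V)` along the leaves of `ker η` through `S` and `g`. -/
lemma isHorizontallyConformal_hessian (hK : IsKenmotsuOn G Γ ζ U) (hV : ContDiffOn ℝ ∞ V U)
    (hf : ContDiffOn ℝ ∞ f U)
    (hsol : ∀ u ∈ U, ∀ v w, lieForm V G u v w + 2 * α * ricForm Γ u v w = f u * G u v w) :
    IsHorizontallyConformal G ζ U
      (fun p => lieForm (solitonField G ζ V) G p + (4 * α) • ricForm Γ p)
      (fun p => f p - dirDeriv ζ f p - 2 * α * (Module.finrank ℝ E - 1)) := by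
  intro u hu v w hv hw
  have sa : ContDiffOn ℝ ∞ (fun p => G p (ζ p) (V p)) U := hK.smooth_form.clm_apply hV
  have dsa := (contDiffOn_dirDeriv hK.isOpen hK.smooth_reeb sa).differentiableAt_of_isOpen
    hK.isOpen hu
  have dζ := hK.differentiableAt_reeb hu
  have dG := hK.toIsMetricOn.differentiableAt hu
  have df := hf.differentiableAt_of_isOpen hK.isOpen hu
  have dS := (contDiffOn_ricForm hK.isOpen hK.smooth_chr).differentiableAt_of_isOpen hK.isOpen hu
  have dB := (contDiffOn_lieBracket hK.isOpen hK.smooth_reeb hV).differentiableAt_of_isOpen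
    hK.isOpen hu
  have h1 := lieForm_comm hK.isOpen hu hK.smooth_reeb hV hK.smooth v w
  have hT : Set.EqOn (lieForm V G) (fun p => f p • G p + (-2 * α) • ricForm Γ p) U :=
    fun p hp => by
      ext v w
      simp only [add_apply, smul_apply, smul_eq_mul]
      linarith [hsol p hp v w]
  rw [hK.lieForm_lieForm_reeb_metric hu, hK.lieForm_formSq hu hV, hv, hw,
    lieForm_congr hK.isOpen hu hT, lieForm_add_smul (df.fun_smul dG) dS, lieForm_fun_smul df dG,
    hK.lieForm_reeb_ricForm hu, hK.lieForm_reeb_metric hu, hv] at h1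
  unfold solitonField
  rw [add_apply, add_apply, lieForm_add_smul_field (dsa.fun_smul dζ) dB, ← h1,
    lieForm_fun_smul_field dsa dζ, hK.lieForm_reeb_metric hu, hv, hK.symm u hu v (ζ u), hv, hw]
  have h2 := hsol u hu v w
  have h3 := hK.two_mul_dirDeriv_form hV hsol hu
  simp only [smul_apply, smul_eq_mul, dirDeriv.eq_1 ζ f]
  linear_combination 2 * h2 + G u v w * h3

lemma exists_horizontal_ne_zero (hd : 1 < Module.finrank ℝ E) (θ : E →L[ℝ] ℝ) :
    ∃ v, v ≠ 0 ∧ θ v = 0 := by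
  have : LinearMap.ker (θ : E →ₗ[ℝ] ℝ) ≠ ⊥ :=
    LinearMap.ker_ne_bot_of_finrank_lt (by simpa using hd)
  obtain ⟨v, hv, h0⟩ := Submodule.exists_mem_ne_zero_of_ne_bot this
  exact ⟨v, h0, hv⟩

/-- The form `L_Y g` for the horizontal gradient `Y` of `ζ(η(V))`, on `ker η`. The Ricci tensor no
longer enters, because `L_ζ S` is a multiple of `g` on `ker η`. -/
lemma isHorizontallyConformal_soliton (hK : IsKenmotsuOn G Γ ζ U) (hV : ContDiffOn ℝ ∞ V U)
    (hf : ContDiffOn ℝ ∞ f U)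
    (hsol : ∀ u ∈ U, ∀ v w, lieForm V G u v w + 2 * α * ricForm Γ u v w = f u * G u v w)
    (hρ : ContDiffOn ℝ ∞ ρ U) (hρ' : ∀ u ∈ U, dirDeriv ζ ρ u = -2 * ρ u) {β : ℝ}
    (hμ : ContDiffOn ℝ ∞ μ U)
    (hμf : ∀ u ∈ U, 2 * μ u = f u + 2 * α * (Module.finrank ℝ E - 1) + β * ρ u) :
    IsHorizontallyConformal G ζ U (lieForm (nextField ζ (solitonField G ζ V)) G)
      (fun p => 4 * μ p + (-2) * dirDeriv ζ μ p + (-2) * dirDeriv ζ (dirDeriv ζ μ) p) := by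
  have hU := hK.isOpen
  have sD : ∀ {h : E → ℝ}, ContDiffOn ℝ ∞ h U → ContDiffOn ℝ ∞ (dirDeriv ζ h) U :=
    fun h => contDiffOn_dirDeriv hU hK.smooth_reeb h
  have dμ : ∀ u ∈ U, DifferentiableAt ℝ μ u := fun u hu => hμ.differentiableAt_of_isOpen hU hu
  have dμ1 : ∀ u ∈ U, DifferentiableAt ℝ (dirDeriv ζ μ) u :=
    fun u hu => (sD hμ).differentiableAt_of_isOpen hU hu
  have dρ : ∀ u ∈ U, DifferentiableAt ℝ ρ u := fun u hu => hρ.differentiableAt_of_isOpen hU hu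
  have g0 := hK.isHorizontalGradient_soliton hV hsol
  have sT := contDiffOn_lieForm hU g0.smooth hK.smooth
  have sS := contDiffOn_ricForm hU hK.smooth_chr
  have sF : ContDiffOn ℝ ∞
      (fun p => lieForm (solitonField G ζ V) G p + (4 * α) • ricForm Γ p) U :=
    sT.add (contDiffOn_const.fun_smul sS)
  have sc : ContDiffOn ℝ ∞ (fun p => f p - dirDeriv ζ f p - 2 * α * (Module.finrank ℝ E - 1)) U :=
    (hf.sub (sD hf)).sub contDiffOn_const
  have h0 := hK.isHorizontallyConformal_lieForm sF sc
    (hK.isHorizontallyConformal_hessian hV hf hsol)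
  intro u hu v w hv hw
  have h1 := h0 u hu v w hv hw
  rw [lieForm_add_smul (sT.differentiableAt_of_isOpen hU hu)
    (sS.differentiableAt_of_isOpen hU hu), hK.lieForm_succ g0 hu, hK.lieForm_reeb_ricForm hu,
    hv] at h1
  have hc : dirDeriv ζ (fun p => f p - dirDeriv ζ f p - 2 * α * (Module.finrank ℝ E - 1)) u =
      dirDeriv ζ f u - dirDeriv ζ (dirDeriv ζ f) u := by
    have e1 := hf.differentiableAt_of_isOpen hU hu
    have e2 := (sD hf).differentiableAt_of_isOpen hU hu
    rw [dirDeriv, fderiv_sub_const, fderiv_fun_sub e1 e2, sub_apply]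
    rfl
  -- `f = 2 ζ(a) - 2 α (d - 1)` turns into an expression in `μ` and `ρ`
  have f0 : Set.EqOn f (fun p =>
      (2 * μ p + (-β) * ρ p) + 1 * (-2 * α * (Module.finrank ℝ E - 1))) U :=
    fun p hp => by
      have := hμf p hp
      simp only
      linarith
  have f1 : Set.EqOn (dirDeriv ζ f) (fun p => 2 * dirDeriv ζ μ p + (2 * β) * ρ p) U :=
    fun p hp => by
      rw [dirDeriv_congr hU f0 hp, dirDeriv_add_smul
        (((dμ p hp).const_mul 2).fun_add ((dρ p hp).const_mul _)) (differentiableAt_const _),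
        dirDeriv_add_smul ((dμ p hp).const_mul 2) (dρ p hp), hρ' p hp, dirDeriv,
        fderiv_const_mul (dμ p hp)]
      simp [dirDeriv]
      ring
  have f2 : dirDeriv ζ (dirDeriv ζ f) u = 2 * dirDeriv ζ (dirDeriv ζ μ) u - 4 * β * ρ u := by
    rw [dirDeriv_congr hU f1 hu, dirDeriv_add_smul ((dμ1 u hu).const_mul 2) (dρ u hu), hρ' u hu,
      dirDeriv, fderiv_const_mul (dμ1 u hu)]
    simp [dirDeriv]
    ring
  simp only [hc, f2, f1 hu] at h1
  have f0' := f0 hu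
  simp only at f0'
  rw [f0'] at h1
  simp only
  linear_combination h1

/-- The passage from the horizontal gradient of `a` to that of `ζ(a)`: the conformal factor `c` of
`L_X g` on `ker η` becomes `ζ(c) + 2 c`. -/
lemma isHorizontallyConformal_succ (hK : IsKenmotsuOn G Γ ζ U) (hμ : ContDiffOn ℝ ∞ μ U)
    (h3 : ∀ u ∈ U, dirDeriv ζ (dirDeriv ζ (dirDeriv ζ μ)) u = 0) {X : E → E} {a : E → ℝ}
    {x y z : ℝ} (hX : IsHorizontalGradient G ζ U a X)
    (h : IsHorizontallyConformal G ζ U (lieForm X G)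
      (fun p => x * μ p + y * dirDeriv ζ μ p + z * dirDeriv ζ (dirDeriv ζ μ) p)) :
    IsHorizontallyConformal G ζ U (lieForm (nextField ζ X) G)
      (fun p => 2 * x * μ p + (x + 2 * y) * dirDeriv ζ μ p
        + (y + 2 * z) * dirDeriv ζ (dirDeriv ζ μ) p) := by
  intro u hu v w hv hw
  have s1 := contDiffOn_dirDeriv hK.isOpen hK.smooth_reeb hμ
  have s2 := contDiffOn_dirDeriv hK.isOpen hK.smooth_reeb s1
  have h1 := hK.isHorizontallyConformal_lieForm (contDiffOn_lieForm hK.isOpen hX.smooth hK.smooth)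
    (((contDiffOn_const.mul hμ).add (contDiffOn_const.mul s1)).add (contDiffOn_const.mul s2))
    h u hu v w hv hw
  rw [hK.lieForm_succ hX hu] at h1
  simp only [hK.dirDeriv_combination hμ h3 x y z hu] at h1
  simp only
  linear_combination h1

/-- The soliton equation forces the function `μ`, a polynomial of degree at most two along the
integral curves of `ζ`, to vanish; here `2 μ = f + 2 α (d - 1) + β ρ` with `ζ(ρ) = -2 ρ`. -/
theorem soliton_function_eq_zero (hK : IsKenmotsuOn G Γ ζ U) (hd : 1 < Module.finrank ℝ E)
    (hV : ContDiffOn ℝ ∞ V U) (hf : ContDiffOn ℝ ∞ f U)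
    (hsol : ∀ u ∈ U, ∀ v w, lieForm V G u v w + 2 * α * ricForm Γ u v w = f u * G u v w)
    (hρ : ContDiffOn ℝ ∞ ρ U) (hρ' : ∀ u ∈ U, dirDeriv ζ ρ u = -2 * ρ u) {β : ℝ}
    (hμ : ContDiffOn ℝ ∞ μ U)
    (hμf : ∀ u ∈ U, 2 * μ u = f u + 2 * α * (Module.finrank ℝ E - 1) + β * ρ u)
    (h3 : ∀ u ∈ U, dirDeriv ζ (dirDeriv ζ (dirDeriv ζ μ)) u = 0) :
    ∀ u ∈ U, μ u = 0 := by
  have hU := hK.isOpen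
  have sD : ∀ {h : E → ℝ}, ContDiffOn ℝ ∞ h U → ContDiffOn ℝ ∞ (dirDeriv ζ h) U :=
    fun h => contDiffOn_dirDeriv hU hK.smooth_reeb h
  have s1 := sD hμ
  have s2 := sD s1
  have dμ : ∀ u ∈ U, DifferentiableAt ℝ μ u := fun u hu => hμ.differentiableAt_of_isOpen hU hu
  have dμ1 : ∀ u ∈ U, DifferentiableAt ℝ (dirDeriv ζ μ) u :=
    fun u hu => s1.differentiableAt_of_isOpen hU hu
  have dμ2 : ∀ u ∈ U, DifferentiableAt ℝ (dirDeriv ζ (dirDeriv ζ μ)) u :=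
    fun u hu => s2.differentiableAt_of_isOpen hU hu
  have dρ : ∀ u ∈ U, DifferentiableAt ℝ ρ u := fun u hu => hρ.differentiableAt_of_isOpen hU hu
  -- the derivatives of `a = η(V)` along `ζ`; from the fourth on, only the part in `ρ` is left
  set a : E → ℝ := fun p => G p (ζ p) (V p)
  have a1 : Set.EqOn (dirDeriv ζ a) (fun p => μ p + (-β / 2) * ρ p) U := fun p hp => by
    have h1 := hK.two_mul_dirDeriv_form hV hsol hp
    have h2 := hμf p hp
    simp only
    linarith
  have a2 : Set.EqOn (dirDeriv ζ (dirDeriv ζ a)) (fun p => dirDeriv ζ μ p + β * ρ p) U :=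
    fun p hp => by
      rw [dirDeriv_congr hU a1 hp, dirDeriv_add_smul (dμ p hp) (dρ p hp), hρ' p hp]
      ring
  have a3 : Set.EqOn (dirDeriv ζ (dirDeriv ζ (dirDeriv ζ a)))
      (fun p => dirDeriv ζ (dirDeriv ζ μ) p + (-2 * β) * ρ p) U := fun p hp => by
    rw [dirDeriv_congr hU a2 hp, dirDeriv_add_smul (dμ1 p hp) (dρ p hp), hρ' p hp]
    ring
  have a4 : Set.EqOn (dirDeriv ζ (dirDeriv ζ (dirDeriv ζ (dirDeriv ζ a))))
      (fun p => (4 * β) * ρ p) U := fun p hp => by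
    rw [dirDeriv_congr hU a3 hp, dirDeriv_add_smul (dμ2 p hp) (dρ p hp), hρ' p hp, h3 p hp]
    ring
  have a5 : Set.EqOn (dirDeriv ζ (dirDeriv ζ (dirDeriv ζ (dirDeriv ζ (dirDeriv ζ a)))))
      (fun p => (-8 * β) * ρ p) U := fun p hp => by
    rw [dirDeriv_congr hU a4 hp, dirDeriv, fderiv_const_mul (dρ p hp)]
    simp only [smul_apply, smul_eq_mul]
    rw [← dirDeriv, hρ' p hp]
    ring
  set b4 := dirDeriv ζ (dirDeriv ζ (dirDeriv ζ (dirDeriv ζ a)))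
  set b5 := dirDeriv ζ b4
  -- their horizontal gradients
  have g0 := hK.isHorizontalGradient_soliton hV hsol
  have g1 := hK.isHorizontalGradient_succ g0
  have g2 := hK.isHorizontalGradient_succ g1
  have g3 := hK.isHorizontalGradient_succ g2
  have g4 : IsHorizontalGradient G ζ U b4 _ := hK.isHorizontalGradient_succ g3
  have g5 : IsHorizontalGradient G ζ U b5 _ := hK.isHorizontalGradient_succ g4
  have c1 := hK.isHorizontallyConformal_soliton hV hf hsol hρ hρ' hμ hμf
  have c4 := hK.isHorizontallyConformal_succ hμ h3 g3
    (hK.isHorizontallyConformal_succ hμ h3 g2 (hK.isHorizontallyConformal_succ hμ h3 g1 c1))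
  have c5 := hK.isHorizontallyConformal_succ hμ h3 g4 c4
  set X4 := nextField ζ (nextField ζ (nextField ζ (nextField ζ (solitonField G ζ V))))
  set X5 := nextField ζ X4
  -- `ζ⁵(a) + 2 ζ⁴(a)` vanishes, and so does its horizontal gradient
  have hX : Set.EqOn (fun p => X5 p + (2 : ℝ) • X4 p)
      (fun _ => 0) U := fun p hp => by
    refine hK.ext hp fun y => ?_
    have e5 := fderiv_congr_of_eqOn hU hp a5
    have e4 := fderiv_congr_of_eqOn hU hp a4
    rw [fderiv_const_mul (dρ p hp)] at e4 e5
    simp only [map_add, add_apply, map_smul, smul_apply, g5.eq p hp, g4.eq p hp, map_zero,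
      zero_apply, smul_eq_mul, dirDeriv.eq_1 ζ b5, dirDeriv.eq_1 ζ b4, e4, e5]
    ring
  refine fun u hu => hK.eq_zero_of_combination hμ h3 (x := 128) (y := 160) (z := -32)
    (by norm_num) (fun u hu => ?_) hu
  -- compare the forms `L_X g` at a nonzero horizontal vector
  obtain ⟨v, hv0, hv⟩ := exists_horizontal_ne_zero hd (G u (ζ u))
  have h4 := c4 u hu v v hv hv
  have h5 := c5 u hu v v hv hv
  have h6 : lieForm (fun p => X5 p + (2 : ℝ) • X4 p) G u v v
      = 0 := by
    have h7 : X5 u + (2 : ℝ) • X4 u = 0 := hX hu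
    rw [lieForm_apply, fderiv_congr_of_eqOn hU hu hX, h7]
    simp
  rw [lieForm_add_smul_field (g5.smooth.differentiableAt_of_isOpen hU hu)
    (g4.smooth.differentiableAt_of_isOpen hU hu), h4, h5] at h6
  refine mul_right_cancel₀ (hK.pos u hu v hv0).ne' ?_
  simp only at h6
  linear_combination h6

end IsKenmotsuOn
end Coord

/-! ### Coordinate expressions of the structures on the manifold -/

namespace Coord

variable {m : ℕ} {U : Set (Space m)} {u : Space m} {G : Space m → Space m →L[ℝ] Space m →L[ℝ] ℝ}

/-- The continuous linear map with the coefficients `L u ∂_i`. It agrees with `L u` when `L u` is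
linear. -/
def linOf (L : Space m → Space m → Space m) (u : Space m) : Space m →L[ℝ] Space m :=
  ∑ i, (EuclideanSpace.proj i : Space m →L[ℝ] ℝ).smulRight (L u (basisVec i))

lemma linOf_apply {L : Space m → Space m → Space m} (A : Space m →ₗ[ℝ] Space m)
    (hA : ∀ v, L u v = A v) (v : Space m) : linOf L u v = L u v := by
  conv_rhs => rw [hA, ← sum_apply_smul_basisVec v]
  simp only [linOf, hA, sum_apply, ContinuousLinearMap.smulRight_apply, PiLp.proj_apply, map_sum,
    map_smul]

lemma contDiffOn_linOf {L : Space m → Space m → Space m}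
    (hL : ∀ i, ContDiffOn ℝ ∞ (fun u => L u (basisVec i)) U) : ContDiffOn ℝ ∞ (linOf L) U := by
  unfold linOf
  exact ContDiffOn.sum fun i _ => contDiffOn_const.smulRight (hL i)

lemma IsMetricOn.lieMetric_eq (hG : IsMetricOn G U) (hu : u ∈ U) (V : Space m → Space m)
    (v w : Space m) : lieMetric (fun u v w => G u v w) V u v w = lieForm V G u v w := by
  rw [lieMetric, lieForm_apply, fderiv_apply₂_const (hG.differentiableAt hu)]
  simp [VectorField.lieBracket]

lemma IsMetricOn.covEndo_eq (hG : IsMetricOn G U) (hu : u ∈ U) {Φ : Space m → Space m →L[ℝ] Space m}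
    (hΦ : DifferentiableAt ℝ Φ u) (v w : Space m) :
    covEndo (fun u v w => G u v w) (fun u v => Φ u v) u v w =
      fderiv ℝ Φ u v w + chr G u v (Φ u w) - Φ u (chr G u v w) := by
  rw [covEndo, hG.cov_const hu, cov, fderiv_apply_const hΦ, hG.chr_apply hu v (Φ u w)]

/-- The integral curves of `ζ` are geodesics, so that `Hess_f(ζ, ζ) = ζ(ζ(f))`. -/
lemma IsKenmotsuOn.hessian_reeb {ζ : Space m → Space m} (hK : IsKenmotsuOn G (chr G) ζ U)
    {f : Space m → ℝ} (hf : ContDiffOn ℝ ∞ f U) (hu : u ∈ U) :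
    hessian (fun u v w => G u v w) f u (ζ u) (ζ u) = dirDeriv ζ (dirDeriv ζ f) u := by
  have df := (hf.fderiv_infty hK.isOpen).differentiableAt_of_isOpen hK.isOpen hu
  rw [hessian, hK.toIsMetricOn.cov_const hu, fderiv_apply_const df, dirDeriv]
  unfold dirDeriv
  rw [fderiv_apply_field df (hK.differentiableAt_reeb hu), hK.fderiv_reeb hu, hK.unit u hu,
    one_smul, sub_self, zero_sub, map_neg, sub_eq_add_neg]

end Coord

section ChartExpressions

open Coord

variable {m : ℕ} {M : Type*} [TopologicalSpace M] [ChartedSpace (EuclideanSpace ℝ (Fin m)) M]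
  [IsManifold (𝓡 m) ∞ M] {e : OpenPartialHomeomorph M (EuclideanSpace ℝ (Fin m))}

/-- The metric in the chart `e`, as a field of continuous bilinear forms. -/
def SmoothMetric.formInChart (g : SmoothMetric m M)
    (e : OpenPartialHomeomorph M (EuclideanSpace ℝ (Fin m))) :
    Space m → Space m →L[ℝ] Space m →L[ℝ] ℝ :=
  bilinOf (g.inChart e)

lemma SmoothMetric.formInChart_apply (g : SmoothMetric m M) (u v w : Space m) :
    g.formInChart e u v w = g.inChart e u v w :=
  bilinOf_apply (LinearMap.mk₂ ℝ (g.inChart e u)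
    (fun _ _ _ => by simp [SmoothMetric.inChart, fromCoord_add])
    (fun _ _ _ => by simp [SmoothMetric.inChart, fromCoord_smul])
    (fun _ _ _ => by simp [SmoothMetric.inChart, fromCoord_add])
    (fun _ _ _ => by simp [SmoothMetric.inChart, fromCoord_smul])) (fun _ _ => rfl) v w

lemma SmoothMetric.inChart_eq (g : SmoothMetric m M) :
    g.inChart e = fun u v w => g.formInChart e u v w := by
  funext u v w
  rw [g.formInChart_apply]

lemma SmoothMetric.isMetricOn (g : SmoothMetric m M)
    (he : e ∈ IsManifold.maximalAtlas (𝓡 m) ∞ M) : IsMetricOn (g.formInChart e) e.target where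
  isOpen := e.open_target
  smooth := contDiffOn_bilinOf fun _ _ => g.contDiffOn_inChart he _ _
  symm u _ v w := by
    rw [g.formInChart_apply, g.formInChart_apply]
    exact g.symm _ _ _
  pos u hu v hv := by
    rw [g.formInChart_apply]
    refine g.pos _ _ fun h => hv ?_
    rw [← toCoord_fromCoord he hu v, h]
    exact map_zero (mfderiv (𝓡 m) (𝓡 m) e (e.symm u))

/-- The `(1,1)`-tensor field in the chart `e`, as a field of continuous linear maps. -/
def SmoothEndomorphism.endInChart (φ : SmoothEndomorphism m M)
    (e : OpenPartialHomeomorph M (EuclideanSpace ℝ (Fin m))) : Space m → Space m →L[ℝ] Space m :=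
  linOf (φ.inChart e)

lemma SmoothEndomorphism.endInChart_apply (φ : SmoothEndomorphism m M) (u v : Space m) :
    φ.endInChart e u v = φ.inChart e u v :=
  linOf_apply
    { toFun := φ.inChart e u
      map_add' := fun _ _ => by simp [SmoothEndomorphism.inChart, fromCoord_add, toCoord_add]
      map_smul' := fun _ _ => by simp [SmoothEndomorphism.inChart, fromCoord_smul, toCoord_smul] }
    (fun _ => rfl) v

lemma SmoothEndomorphism.contDiffOn_endInChart (φ : SmoothEndomorphism m M)
    (he : e ∈ IsManifold.maximalAtlas (𝓡 m) ∞ M) : ContDiffOn ℝ ∞ (φ.endInChart e) e.target :=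
  contDiffOn_linOf fun _ => φ.contDiffOn_inChart he _

lemma AlmostContactMetricStructure.eta_inChart (A : AlmostContactMetricStructure m M)
    (he : e ∈ IsManifold.maximalAtlas (𝓡 m) ∞ M) {u : Space m} (hu : u ∈ e.target) (v : Space m) :
    A.η.inChart e u v = A.g.formInChart e u v (A.ζ.inChart e u) := by
  rw [SmoothMetric.formInChart_apply, SmoothOneForm.inChart, A.eta_eq, SmoothMetric.inChart,
    SmoothVectorField.inChart, fromCoord_toCoord he hu]

lemma AlmostContactMetricStructure.IsKenmotsu.isKenmotsuOn {A : AlmostContactMetricStructure m M}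
    (hA : A.IsKenmotsu) (he : e ∈ IsManifold.maximalAtlas (𝓡 m) ∞ M) :
    IsKenmotsuOn (A.g.formInChart e) (chr (A.g.formInChart e)) (A.ζ.inChart e) e.target := by
  have hG := A.g.isMetricOn he
  have hΦ := A.φ.contDiffOn_endInChart he
  have hφ : A.φ.inChart e = fun u v => A.φ.endInChart e u v := by
    funext u v
    rw [A.φ.endInChart_apply]
  have hζ : ∀ u ∈ e.target, fromCoord e u (A.ζ.inChart e u) = A.ζ (e.symm u) :=
    fun u hu => fromCoord_toCoord he hu _
  have hφ' : ∀ u ∈ e.target, ∀ v, fromCoord e u (A.φ.endInChart e u v) =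
      A.φ (e.symm u) (fromCoord e u v) := fun u hu v => by
    rw [A.φ.endInChart_apply]
    exact fromCoord_toCoord he hu _
  refine hG.isLeviCivitaOn.isKenmotsuOn (A.ζ.contDiffOn_inChart he) (fun u hu => ?_) hΦ
    (fun u hu v => ?_) (fun u hu v w => ?_) (fun u hu v w => ?_)
  · rw [A.g.formInChart_apply, SmoothMetric.inChart, hζ u hu]
    exact A.unit _
  · rw [← A.eta_inChart he hu, A.φ.endInChart_apply, SmoothEndomorphism.inChart, hφ' u hu,
      A.phi_sq, toCoord_add, toCoord_smul, ← neg_one_smul ℝ, toCoord_smul, toCoord_fromCoord he hu,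
      neg_one_smul]
    rfl
  · rw [← A.eta_inChart he hu, ← A.eta_inChart he hu, A.g.formInChart_apply, A.g.formInChart_apply,
      SmoothMetric.inChart, hφ' u hu, hφ' u hu, A.compatible]
    rfl
  · have h := hA e he u hu v w
    rw [A.eta_inChart he hu, A.g.inChart_eq, hφ, hG.covEndo_eq hu
      (hΦ.differentiableAt_of_isOpen e.open_target hu)] at h
    exact h

/-- The local result in the chart at each point: the function of the soliton is the constant of the
theorem. -/
lemma AlmostContactMetricStructure.IsKenmotsu.soliton_function_eq {n : ℕ} (hn : 1 < n)
    {M : Type*} [TopologicalSpace M] [ChartedSpace (EuclideanSpace ℝ (Fin (2 * n + 1))) M]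
    [IsManifold (𝓡 (2 * n + 1)) ∞ M] {A : AlmostContactMetricStructure (2 * n + 1) M}
    (hA : A.IsKenmotsu) {α β : ℝ} {V : SmoothVectorField (2 * n + 1) M} {lam : M → ℝ}
    (hsol : IsAlmostRicciYamabeSoliton A.g V lam α β) (hHess : HessianConstantAlong A.g lam A.ζ) :
    ∀ x, lam x = -2 * n * α - n * β * (2 * n + 1) := by
  intro x
  set e := chartAt (EuclideanSpace ℝ (Fin (2 * n + 1))) x
  have he : e ∈ IsManifold.maximalAtlas (𝓡 (2 * n + 1)) ∞ M :=
    IsManifold.chart_mem_maximalAtlas x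
  set G := A.g.formInChart e
  set ζ := A.ζ.inChart e
  set l : Space (2 * n + 1) → ℝ := fun u => lam (e.symm u) with hl
  have hK : IsKenmotsuOn G (chr G) ζ e.target := hA.isKenmotsuOn he
  have hG := hK.toIsMetricOn
  have hd : (Module.finrank ℝ (Space (2 * n + 1)) : ℝ) = 2 * n + 1 := by simp
  have sl : ContDiffOn ℝ ∞ l e.target := contMDiffOn_iff_contDiffOn.1
    (hsol.1.comp_contMDiffOn (contMDiffOn_symm_of_mem_maximalAtlas he))
  have sr : ContDiffOn ℝ ∞ (fun p => traceL (Space (2 * n + 1)) (ricciOp G p)) e.target :=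
    (traceL (Space (2 * n + 1))).contDiff.comp_contDiffOn hG.contDiffOn_ricciOp
  -- `f = 2 λ - β r`, `ρ = r + d (d - 1)`, and `μ` is `λ` minus the asserted constant
  have hμ := hK.soliton_function_eq_zero (α := α) (β := β) (V := V.inChart e)
    (f := fun p => 2 * l p - β * traceL (Space (2 * n + 1)) (ricciOp G p))
    (ρ := fun p => traceL (Space (2 * n + 1)) (ricciOp G p) + (2 * n + 1) * (2 * n))
    (μ := fun p => l p + (2 * n * α + n * β * (2 * n + 1))) (by simp; omega)
    (V.contDiffOn_inChart he) ((contDiffOn_const.mul sl).sub (contDiffOn_const.mul sr))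
    (fun u hu v w => ?_) (sr.add contDiffOn_const) (fun u hu => ?_) (sl.add contDiffOn_const)
    (fun u hu => ?_) (fun u hu => ?_) (e x) (e.map_source (mem_chart_source _ x))
  · have hx : e.symm (e x) = x := e.left_inv (mem_chart_source _ x)
    simp only [hl, hx] at hμ
    linarith
  · have h := hsol.2 e he u hu v w
    rw [A.g.inChart_eq, hG.lieMetric_eq hu, hG.ricci_eq hu, hG.scalarCurvature_eq hu] at h
    exact h
  · have h := hK.fderiv_trace_ricci_reeb hu hG.contDiffOn_ricciOp
      fun p hp => hG.inner_ricciOp hp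
    rw [dirDeriv, fderiv_add_const, h, hd]
    ring
  · rw [hd]
    ring
  · have h := hHess e he u hu
    have h1 : dirDeriv ζ (fun p => l p + (2 * n * α + n * β * (2 * n + 1))) = dirDeriv ζ l := by
      funext p
      rw [dirDeriv, fderiv_add_const, dirDeriv]
    rw [A.g.inChart_eq, fderiv_congr_of_eqOn e.open_target hu
      fun p hp => hK.hessian_reeb sl hp] at h
    rw [h1]
    exact h

end ChartExpressions

end

theorem mainTheorem2 (n : ℕ) (hn : 1 < n)
    {M : Type*} [TopologicalSpace M]
    [ChartedSpace (EuclideanSpace ℝ (Fin (2 * n + 1))) M]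
    [IsManifold (𝓡 (2 * n + 1)) ∞ M]
    (A : AlmostContactMetricStructure (2 * n + 1) M) (hA : A.IsKenmotsu)
    (α β : ℝ) (V : SmoothVectorField (2 * n + 1) M) (lam : M → ℝ)
    (hsol : IsAlmostRicciYamabeSoliton A.g V lam α β)
    (hHess : HessianConstantAlong A.g lam A.ζ) :
    (∀ x, lam x = -2 * n * α - n * β * (2 * n + 1)) ∧
      IsRicciYamabeSoliton A.g V (-2 * n * α - n * β * (2 * n + 1)) α β := by
  have key := hA.soliton_function_eq hn hsol hHess
  have hlam : lam = fun _ => -2 * n * α - n * β * (2 * n + 1) := funext key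
  refine ⟨key, ?_⟩
  rw [IsRicciYamabeSoliton, ← hlam]
  exact hsol.2
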